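/- Let $d\ge 2$, $m\ge 1$ and $\ell\ge 0$ be integers with $2m\ge d$. Equip $L^2(\mathbb S^{d-1})$ (real-valued functions) with the inner product $\frac1{\sigma_d}\int_{\mathbb S^{d-1}} fg\,d\sigma$, where $\sigma$ is the surface measure and $\sigma_d=\sigma(\mathbb S^{d-1})$. For $n\ge 0$ let $\mathcal H^d_n$ be the space of restrictions to $\mathbb S^{d-1}$ of real harmonic polynomials on $\mathbb R^d$ that are homogeneous of degree $n$, let $N_{d,n}=\dim\mathcal H^d_n$, and let $Y^n_1,\dots,Y^n_{N_{d,n}}$ be any orthonormal basis of $\mathcal H^d_n$. For $f\in L^2(\mathbb S^{d-1})$ let $a_{nj}(f)=\langle f,Y^n_j\rangle$. Let $\mathcal F^{d,\ell}_m$ be the space of all $f\in L^2(\mathbb S^{d-1})$ with $$\sum_{n=1}^\infty [n(n+d-2)]^m\sum_{j=1}^{N_{d,n}}a_{nj}(f)^2<\infty \quad\text{and}\quad a_{nj}(f)=0\ \text{ for } 0\le n\le \ell,\ 1\le j\le N_{d,n},$$ and put $$(f,g)_{m,\ell}=\sum_{n=\ell+1}^\infty [n(n+d-2)]^m\sum_{j=1}^{N_{d,n}}a_{nj}(f)\,a_{nj}(g).$$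 Let $\lambda=\frac{d-2}2$, let $W^\lambda_n(t)={}_2F_1\big(-n,n+2\lambda;\lambda+\tfrac12;\tfrac{1-t}2\big)$ be the Gegenbauer polynomial of order $\lambda$ and degree $n$ normalized so that $W_n^\lambda(1)=1$, and for $x,y\in\mathbb S^{d-1}$ let $$K_{d,m,\ell}(x,y)=\sum_{n=\ell+1}^\infty [n(n+d-2)]^{-m}N_{d,n}W^\lambda_n(x\cdot y).$$ Then the series defining $K_{d,m,\ell}(x,y)$ (for $x,y\in\mathbb S^{d-1}$) and $(f,g)_{m,\ell}$ (for $f,g\in\mathcal F^{d,\ell}_m$) converge absolutely, every element of $\mathcal F^{d,\ell}_m$ has exactly one continuous representative (with which it is identified), and: (a) $\mathcal F^{d,\ell}_m$ with the inner product $(\cdot,\cdot)_{m,\ell}$ is a Hilbert space and $K_{d,m,\ell}$ is its reproducing kernel: for every $y\in\mathbb S^{d-1}$ one has $K_{d,m,\ell}(\cdot,y)\in\mathcal F^{d,\ell}_m$, and $(f,K_{d,m,\ell}(\cdot,y))_{m,\ell}=f(y)$ for all $f\in\mathcal F^{d,\ell}_m$. (b) $K_{d,m,\ell}$ is continuous on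 $\mathbb S^{d-1}\times\mathbb S^{d-1}$, symmetric and strictly positive definite: for every $k\ge 1$, all pairwise distinct $x_1,\dots,x_k\in\mathbb S^{d-1}$ and all nonzero $a\in\mathbb R^k$, $$\sum_{i=1}^k\sum_{j=1}^k a_ia_jK_{d,m,\ell}(x_i,x_j)>0.$$ -/

import Mathlib

open MeasureTheory Filter Topology

noncomputable section

namespace SphereSpline

/-! ### The sphere, its normalized surface measure, and spherical harmonics -/

/-- The unit sphere `S^{d-1}` of `ℝ^d`. -/
abbrev Sph (d : ℕ) : Type := Metric.sphere (0 : EuclideanSpace ℝ (Fin d)) 1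

/-- The surface measure of `S^{d-1}`, divided by the total surface area. -/
def sphMeasure (d : ℕ) : Measure (Sph d) :=
  ((volume : Measure (EuclideanSpace ℝ (Fin d))).toSphere Set.univ)⁻¹ •
    (volume : Measure (EuclideanSpace ℝ (Fin d))).toSphere

instance sphMeasure_isFinite (d : ℕ) : IsFiniteMeasure (sphMeasure d) := by
  refine ⟨?_⟩
  rw [sphMeasure, Measure.smul_apply, smul_eq_mul]
  exact lt_of_le_of_lt (ENNReal.inv_mul_le_one _) ENNReal.one_lt_top

/-- `L²(S^{d-1})` with the inner product `(1/σ_d) ∫ f g dσ`. -/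
abbrev L2 (d : ℕ) : Type := Lp ℝ 2 (sphMeasure d)

/-- The class in `L²(S^{d-1})` of a continuous function. -/
abbrev toL2 (d : ℕ) : C(Sph d, ℝ) →L[ℝ] L2 d := ContinuousMap.toLp 2 (sphMeasure d) ℝ

/-- The Laplacian on polynomials in `d` variables. -/
def laplacian (d : ℕ) : MvPolynomial (Fin d) ℝ →ₗ[ℝ] MvPolynomial (Fin d) ℝ :=
  ∑ i, (MvPolynomial.pderiv i).toLinearMap ∘ₗ (MvPolynomial.pderiv i).toLinearMap

/-- The real harmonic polynomials on `ℝ^d` that are homogeneous of degree `n`. -/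
def harmonicPoly (d n : ℕ) : Submodule ℝ (MvPolynomial (Fin d) ℝ) :=
  MvPolynomial.homogeneousSubmodule (Fin d) ℝ n ⊓ LinearMap.ker (laplacian d)

/-- Restriction of a polynomial on `ℝ^d` to the sphere. -/
def restrictSph (d : ℕ) : MvPolynomial (Fin d) ℝ →ₗ[ℝ] C(Sph d, ℝ) :=
  (MvPolynomial.aeval (fun i : Fin d =>
    (⟨fun x => (x : EuclideanSpace ℝ (Fin d)) i, by fun_prop⟩ : C(Sph d, ℝ)))).toLinearMap

/-- The spherical harmonics of degree `n`, as a subspace of `L²(S^{d-1})`. -/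
def sphHarm (d n : ℕ) : Submodule ℝ (L2 d) :=
  ((harmonicPoly d n).map (restrictSph d)).map (toL2 d).toLinearMap

/-- `N_{d,n}`, the dimension of the space of spherical harmonics of degree `n`. -/
def dimHarm (d n : ℕ) : ℕ := Module.finrank ℝ (sphHarm d n)

/-- A choice, for every degree `n`, of an orthonormal basis `Y_1^n, …, Y_{N_{d,n}}^n` of the
spherical harmonics of degree `n`. -/
abbrev HarmBasis (d : ℕ) : Type :=
  (n : ℕ) → OrthonormalBasis (Fin (dimHarm d n)) ℝ (sphHarm d n)

/-- The number `n (n + d - 2)`; its negative is the eigenvalue of the Laplace-Beltrami operator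
on the spherical harmonics of degree `n`. -/
def eig (d n : ℕ) : ℝ := (n : ℝ) * ((n : ℝ) + (d : ℝ) - 2)

/-! ### The Sobolev-type spaces -/

/-- The Fourier coefficient `a_{nj} = ⟨f, Y_j^n⟩`. -/
def fourierCoeff {d : ℕ} (Y : HarmBasis d) (f : L2 d) (n : ℕ) (j : Fin (dimHarm d n)) : ℝ :=
  inner ℝ ((Y n j : sphHarm d n) : L2 d) f

/-- The degree `n` term `[n (n + d - 2)]^m ∑_j a_{nj} b_{nj}` of the energy of `f` and `g`. -/
def energyTerm {d : ℕ} (m : ℕ) (Y : HarmBasis d) (f g : L2 d) (n : ℕ) : ℝ :=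
  eig d n ^ m * ∑ j, fourierCoeff Y f n j * fourierCoeff Y g n j

lemma fourierCoeff_add {d : ℕ} (Y : HarmBasis d) (f g : L2 d) (n : ℕ) (j : Fin (dimHarm d n)) :
    fourierCoeff Y (f + g) n j = fourierCoeff Y f n j + fourierCoeff Y g n j :=
  inner_add_right _ _ _

lemma fourierCoeff_zero {d : ℕ} (Y : HarmBasis d) (n : ℕ) (j : Fin (dimHarm d n)) :
    fourierCoeff Y 0 n j = 0 :=
  inner_zero_right _

lemma fourierCoeff_smul {d : ℕ} (Y : HarmBasis d) (c : ℝ) (f : L2 d) (n : ℕ)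
    (j : Fin (dimHarm d n)) : fourierCoeff Y (c • f) n j = c * fourierCoeff Y f n j :=
  real_inner_smul_right _ _ _

/-- The space `F_m^d` of the `f ∈ L²(S^{d-1})` with
`∑_{n ≥ 1} [n (n + d - 2)]^m ∑_j a_{nj}^2 < ∞`. -/
def sobolev (d m : ℕ) (Y : HarmBasis d) : Submodule ℝ (L2 d) where
  carrier := {f | Summable fun n : ℕ => energyTerm m Y f f (n + 1)}
  zero_mem' := by simp [energyTerm, fourierCoeff_zero, summable_zero]
  add_mem' := by
    intro f g hf hg
    refine Summable.of_norm_bounded ((hf.abs.add hg.abs).mul_left 2) fun n => ?_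
    have hS : ∀ h : L2 d, 0 ≤ ∑ j, fourierCoeff Y h (n + 1) j * fourierCoeff Y h (n + 1) j :=
      fun h => Finset.sum_nonneg fun j _ => mul_self_nonneg _
    simp only [energyTerm, Real.norm_eq_abs, abs_mul, abs_of_nonneg (hS _)]
    rw [← mul_add, ← Finset.sum_add_distrib, mul_left_comm, Finset.mul_sum _ _ (2 : ℝ)]
    refine mul_le_mul_of_nonneg_left (Finset.sum_le_sum fun j _ => ?_) (abs_nonneg _)
    rw [fourierCoeff_add]
    nlinarith [sq_nonneg (fourierCoeff Y f (n + 1) j - fourierCoeff Y g (n + 1) j)]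
  smul_mem' := by
    intro c f hf
    refine (Summable.mul_left (c * c) hf).congr fun n => ?_
    unfold energyTerm
    rw [mul_left_comm, Finset.mul_sum]
    congr 1
    refine Finset.sum_congr rfl fun j _ => ?_
    rw [fourierCoeff_smul]
    ring

/-- The space `F_m^{d,ℓ}` of the `f ∈ F_m^d` whose Fourier coefficients of degree at most `ℓ`
vanish. -/
def truncSobolev (d m ℓ : ℕ) (Y : HarmBasis d) : Submodule ℝ (L2 d) :=
  sobolev d m Y ⊓
    { carrier := {f | ∀ n ≤ ℓ, ∀ j, fourierCoeff Y f n j = 0}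
      zero_mem' := fun n _ j => fourierCoeff_zero Y n j
      add_mem' := fun {f g} hf hg n hn j => by
        rw [fourierCoeff_add, hf n hn j, hg n hn j, add_zero]
      smul_mem' := fun c f hf n hn j => by
        rw [fourierCoeff_smul, hf n hn j, mul_zero] }

/-- `(f, g)_{m,ℓ} = ∑_{n ≥ ℓ + 1} [n (n + d - 2)]^m ∑_j a_{nj} b_{nj}`. -/
def energy {d : ℕ} (m ℓ : ℕ) (Y : HarmBasis d) (f g : L2 d) : ℝ :=
  ∑' k : ℕ, energyTerm m Y f g (ℓ + 1 + k)

/-- `F_m^{d,ℓ}` as a space of genuine functions: the continuous functions on the sphere whose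
class lies in `F_m^{d,ℓ}`. -/
def truncSobolevC (d m ℓ : ℕ) (Y : HarmBasis d) : Submodule ℝ C(Sph d, ℝ) :=
  (truncSobolev d m ℓ Y).comap (toL2 d).toLinearMap

/-! ### The kernel -/

/-- The Gegenbauer polynomial of order `lam ≥ 0` and degree `n`, normalized to be `1` at `1`.
The Gegenbauer polynomial `C_n^lam` is a multiple of this hypergeometric polynomial; for
`lam = 0` this is the Chebyshev polynomial `T_n`. -/
def gegenbauerW (lam : ℝ) (n : ℕ) (t : ℝ) : ℝ :=
  ordinaryHypergeometric (-(n : ℝ)) ((n : ℝ) + 2 * lam) (lam + 1 / 2) ((1 - t) / 2)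

/-- The degree `n` term `[n (n + d - 2)]^{-m} N_{d,n} W_n^λ(x·y)` of the kernel, where
`λ = (d - 2) / 2`. -/
def kernelTerm (d m : ℕ) (x y : Sph d) (n : ℕ) : ℝ :=
  (eig d n ^ m)⁻¹ * (dimHarm d n : ℝ) *
    gegenbauerW (((d : ℝ) - 2) / 2) n
      (inner ℝ (x : EuclideanSpace ℝ (Fin d)) (y : EuclideanSpace ℝ (Fin d)))

/-- `K_{d,m,ℓ}(x, y) = ∑_{n ≥ ℓ + 1} [n (n + d - 2)]^{-m} N_{d,n} W_n^λ(x·y)`. -/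
def kernel (d m ℓ : ℕ) (x y : Sph d) : ℝ := ∑' k : ℕ, kernelTerm d m x y (ℓ + 1 + k)

/-! ### Hilbert spaces of functions, reproducing kernels, strict positive definiteness -/

/-- `B` is an inner product on the real vector space `E`, and `E` is complete for the norm
`f ↦ √(B f f)`. -/
structure IsHilbert {E : Type*} [AddCommGroup E] [Module ℝ E] (B : E → E → ℝ) : Prop where
  symm : ∀ f g, B f g = B g f
  add_left : ∀ f g h, B (f + g) h = B f h + B g h
  smul_left : ∀ (c : ℝ) f g, B (c • f) g = c * B f g
  pos : ∀ f, f ≠ 0 → 0 < B f f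
  complete : ∀ u : ℕ → E,
    (∀ ε > 0, ∃ n₀ : ℕ, ∀ p ≥ n₀, ∀ q ≥ n₀, √(B (u p - u q) (u p - u q)) < ε) →
    ∃ f, Tendsto (fun p => √(B (u p - f) (u p - f))) atTop (𝓝 0)

/-- `K` is the reproducing kernel of the space `H` of continuous functions on `X`, which is a
Hilbert space for the inner product `B`: every section `K(·, y)` belongs to `H`, and
`B(f, K(·, y)) = f(y)` for all `f ∈ H` and `y ∈ X`. -/
def IsReproducingKernel {X : Type*} [TopologicalSpace X] (H : Submodule ℝ C(X, ℝ))
    (B : H → H → ℝ) (K : X → X → ℝ) : Prop :=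
  IsHilbert B ∧
    ∀ y : X, ∃ k : H, (∀ x, (k : C(X, ℝ)) x = K x y) ∧ ∀ f : H, B f k = (f : C(X, ℝ)) y

/-- Strict positive definiteness of a symmetric kernel: for pairwise distinct points `x_i` and a
nonzero vector `a`, `∑_{i,j} a_i a_j K(x_i, x_j) > 0`. -/
def IsStrictlyPosDef {X : Type*} (K : X → X → ℝ) : Prop :=
  (∀ x y, K x y = K y x) ∧
    ∀ (n : ℕ) (x : Fin n → X) (a : Fin n → ℝ), Function.Injective x → a ≠ 0 →
      0 < ∑ i, ∑ j, a i * a j * K (x i) (x j)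

end SphereSpline

end

/-! ### Rotations and the invariance of the surface measure -/

noncomputable section

namespace SphereSpline

/-! Everything rests on rotation invariance. Differentiating an invariant integral shows that `x_i
∂_j - x_j ∂_i` integrates to zero. On polynomials homogeneous of degree `k` the squares of these
operators sum to `2 (|x|² Δ - k (k + d - 2))`, so `∫ Δf = k (k + d - 2) ∫ f` (`sphInt_laplacian`).
Applied to products, this identity yields orthogonality of different degrees, the decomposition of
polynomials on the sphere into harmonics, and `∫ p(x) (x·y)^n = c_n p(y)` for harmonic `p` of degree
`n`.

The hypergeometric equation makes `x ↦ W_n(x·y)` an eigenfunction of the sum of squared rotations,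
hence a spherical harmonic of degree `n`. Its coefficients are multiples of `Y_j(y)`, and
integration over the diagonal fixes the constant: this is the addition theorem
`sum_harmC_mul_harmC`. In particular `∑_j Y_j(x)² = N_{d,n}`. Since `N_{d,n} = O(n^(d-2))`, the
condition `2m ≥ d` makes `∑ [n(n+d-2)]^{-m} N_{d,n}` converge.

Finite energy therefore forces uniform convergence of the Fourier series, and weighted Fourier
coefficients identify the space with an `ℓ²` space (`coeffMap_bijective`). The section `K(·, y)` has
coefficients `[n(n+d-2)]^{-m} Y_j(y)`, so pairing with it sums the Fourier series at `y`.

For strict positivity, the quadratic form is a weighted sum of squares of `∑_i a_i Y_j(x_i)`. If it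
vanishes, `∑_i a_i δ_{x_i}` kills all harmonics of degree above `ℓ`, so it is integration against a
continuous function. Functions peaking at one `x_i` then give `a_i = 0`, because points are null
sets (`eq_zero_of_sum_harmC_eq_zero`). -/

/-- The rotation by the angle `t` in the plane of the coordinates `i` and `j`. -/
def planeRotLin (d : ℕ) (i j : Fin d) (t : ℝ) :
    EuclideanSpace ℝ (Fin d) →ₗ[ℝ] EuclideanSpace ℝ (Fin d) where
  toFun x := x + ((Real.cos t - 1) * x i - Real.sin t * x j) • EuclideanSpace.single i (1 : ℝ)
    + (Real.sin t * x i + (Real.cos t - 1) * x j) • EuclideanSpace.single j (1 : ℝ)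
  map_add' x y := by
    ext k
    simp only [PiLp.add_apply, PiLp.smul_apply, smul_eq_mul]
    ring
  map_smul' c x := by
    ext k
    simp only [PiLp.add_apply, PiLp.smul_apply, smul_eq_mul, RingHom.id_apply]
    ring

lemma planeRotLin_apply {d : ℕ} (i j : Fin d) (t : ℝ) (x : EuclideanSpace ℝ (Fin d)) (k : Fin d) :
    planeRotLin d i j t x k =
      x k + ((Real.cos t - 1) * x i - Real.sin t * x j) * (if k = i then 1 else 0)
    + (Real.sin t * x i + (Real.cos t - 1) * x j) * (if k = j then 1 else 0) := by
  simp [planeRotLin]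

lemma norm_planeRotLin {d : ℕ} {i j : Fin d} (hij : i ≠ j) (t : ℝ)
    (x : EuclideanSpace ℝ (Fin d)) : ‖planeRotLin d i j t x‖ = ‖x‖ := by
  have h : ‖planeRotLin d i j t x‖ ^ 2 = ‖x‖ ^ 2 := by
    simp only [EuclideanSpace.norm_sq_eq, Real.norm_eq_abs, sq_abs]
    rw [← sub_eq_zero, ← Finset.sum_sub_distrib,
      ← Finset.sum_subset (Finset.subset_univ ({i, j} : Finset (Fin d))), Finset.sum_pair hij]
    · simp only [planeRotLin_apply, if_true, hij, hij.symm, if_false]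
      linear_combination (x i ^ 2 + x j ^ 2) * Real.sin_sq_add_cos_sq t
    · intro k _ hk
      simp only [Finset.mem_insert, Finset.mem_singleton, not_or] at hk
      simp [planeRotLin_apply, hk.1, hk.2]
  exact (sq_eq_sq₀ (norm_nonneg _) (norm_nonneg _)).1 h

/-- The rotation by the angle `t` in the plane of two distinct coordinates, as an isometry. -/
def planeRot {d : ℕ} {i j : Fin d} (hij : i ≠ j) (t : ℝ) :
    EuclideanSpace ℝ (Fin d) ≃ₗᵢ[ℝ] EuclideanSpace ℝ (Fin d) :=
  LinearIsometry.toLinearIsometryEquiv ⟨planeRotLin d i j t, norm_planeRotLin hij t⟩ rfl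

lemma planeRot_apply {d : ℕ} {i j : Fin d} (hij : i ≠ j) (t : ℝ) (x : EuclideanSpace ℝ (Fin d)) :
    planeRot hij t x = planeRotLin d i j t x := rfl

/-- A linear isometry restricted to the sphere. -/
def sphMap {d : ℕ} (R : EuclideanSpace ℝ (Fin d) ≃ₗᵢ[ℝ] EuclideanSpace ℝ (Fin d)) :
    C(Sph d, Sph d) :=
  ⟨fun x => ⟨R x, by simp⟩, by fun_prop⟩

-- The surface measure of `s` is proportional to the volume of the cone `(0,1) • s`, and a linear
-- isometry maps cones to cones and preserves volume.
open scoped Pointwise in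
lemma map_sphMap {d : ℕ} (R : EuclideanSpace ℝ (Fin d) ≃ₗᵢ[ℝ] EuclideanSpace ℝ (Fin d)) :
    (sphMeasure d).map (sphMap R) = sphMeasure d := by
  rw [sphMeasure, Measure.map_smul]
  congr 1
  ext s hs
  have hm : Measurable (sphMap R) := (sphMap R).continuous.measurable
  rw [Measure.map_apply hm hs, Measure.toSphere_apply' _ (hm hs), Measure.toSphere_apply' _ hs]
  congr 1
  conv_rhs => rw [← R.measurePreserving.measure_preimage_equiv
    (f := R.toHomeomorph.toMeasurableEquiv)]
  congr 1
  ext x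
  simp only [Set.mem_smul, Set.mem_image, Set.mem_preimage]
  constructor
  · rintro ⟨r, hr, _, ⟨z, hz, rfl⟩, rfl⟩
    exact ⟨r, hr, _, ⟨_, hz, rfl⟩, (R.map_smul r _).symm⟩
  · rintro ⟨r, hr, _, ⟨z, hz, rfl⟩, hx⟩
    refine ⟨r, hr, _, ⟨⟨R.symm z, by simp⟩, ?_, rfl⟩, ?_⟩
    · convert hz
      ext1
      simp [sphMap]
    · apply R.injective
      rw [R.map_smul]
      simpa using hx

lemma integral_comp_sphMap {d : ℕ}
    (R : EuclideanSpace ℝ (Fin d) ≃ₗᵢ[ℝ] EuclideanSpace ℝ (Fin d)) (f : C(Sph d, ℝ)) :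
    ∫ x, f (sphMap R x) ∂sphMeasure d = ∫ x, f x ∂sphMeasure d := by
  conv_rhs => rw [← map_sphMap R]
  rw [integral_map (sphMap R).continuous.measurable.aemeasurable
    f.continuous.aestronglyMeasurable]

lemma sphMeasure_isProbability {d : ℕ} (hd : 1 ≤ d) : IsProbabilityMeasure (sphMeasure d) := by
  have : Nonempty (Fin d) := ⟨⟨0, hd⟩⟩
  have : Nontrivial (EuclideanSpace ℝ (Fin d)) := inferInstance
  refine ⟨?_⟩
  rw [sphMeasure, Measure.smul_apply, smul_eq_mul]
  refine ENNReal.inv_mul_cancel ?_ (measure_ne_top _ _)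
  rw [Ne, Measure.measure_univ_eq_zero]
  exact Measure.toSphere_ne_zero _

instance sphMeasure_isOpenPos (d : ℕ) : (sphMeasure d).IsOpenPosMeasure := by
  refine ⟨fun U hU hne => ?_⟩
  rw [sphMeasure, Measure.smul_apply, smul_eq_mul]
  exact mul_ne_zero (ENNReal.inv_ne_zero.2 (measure_ne_top _ _)) (hU.measure_ne_zero _ hne)

-- The cone over a point lies in a line, which is a proper subspace once `d ≥ 2`.
open scoped Pointwise in
lemma sphMeasure_singleton {d : ℕ} (hd : 2 ≤ d) (x : Sph d) : sphMeasure d {x} = 0 := by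
  rw [sphMeasure, Measure.smul_apply, smul_eq_mul,
    Measure.toSphere_apply' _ (measurableSet_singleton x)]
  have h : volume (Set.Ioo (0 : ℝ) 1 • ((↑) '' ({x} : Set (Sph d)) :
      Set (EuclideanSpace ℝ (Fin d)))) = 0 := by
    refine measure_mono_null (t := (Submodule.span ℝ {(x : EuclideanSpace ℝ (Fin d))} : Set _))
      ?_ (Measure.addHaar_submodule _ _ ?_)
    · rintro _ ⟨r, _, _, ⟨z, rfl, rfl⟩, rfl⟩
      exact Submodule.smul_mem _ _ (Submodule.mem_span_singleton_self _)
    · intro h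
      have h1 := finrank_span_singleton (K := ℝ)
        (v := (x : EuclideanSpace ℝ (Fin d))) (by
          intro h0
          have := x.2
          rw [h0] at this
          simp at this)
      rw [h, finrank_top] at h1
      simp at h1
      omega
  rw [h, mul_zero, mul_zero]

/-! ### Infinitesimal rotations of polynomials -/

lemma restrictSph_apply {d : ℕ} (f : MvPolynomial (Fin d) ℝ) (x : Sph d) :
    restrictSph d f x = MvPolynomial.eval (fun i => (x : EuclideanSpace ℝ (Fin d)) i) f := by
  simp only [restrictSph, AlgHom.toLinearMap_apply]
  induction f using MvPolynomial.induction_on with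
  | C a => simp
  | add p q hp hq => simp [hp, hq]
  | mul_X p i hp => simp [hp]

/-- The infinitesimal rotation `x_i ∂_j - x_j ∂_i`. -/
def infRot {d : ℕ} (i j : Fin d) :
    Derivation ℝ (MvPolynomial (Fin d) ℝ) (MvPolynomial (Fin d) ℝ) :=
  (MvPolynomial.X i : MvPolynomial (Fin d) ℝ) • MvPolynomial.pderiv j
    - (MvPolynomial.X j : MvPolynomial (Fin d) ℝ) • MvPolynomial.pderiv i

lemma infRot_apply {d : ℕ} (i j : Fin d) (f : MvPolynomial (Fin d) ℝ) :
    infRot i j f = MvPolynomial.X i * MvPolynomial.pderiv j f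
      - MvPolynomial.X j * MvPolynomial.pderiv i f := rfl

/-- The integral over the sphere, as a linear functional on polynomials. -/
def sphInt (d : ℕ) : MvPolynomial (Fin d) ℝ →ₗ[ℝ] ℝ where
  toFun f := ∫ x, restrictSph d f x ∂sphMeasure d
  map_add' f g := by
    simp only [map_add, ContinuousMap.add_apply]
    exact integral_add ((restrictSph d f).continuous.integrable_of_hasCompactSupport
        (HasCompactSupport.of_compactSpace _))
      ((restrictSph d g).continuous.integrable_of_hasCompactSupport
        (HasCompactSupport.of_compactSpace _))
  map_smul' c f := by
    simp only [map_smul, ContinuousMap.smul_apply, smul_eq_mul, RingHom.id_apply]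
    exact integral_const_mul _ _

lemma sphInt_apply {d : ℕ} (f : MvPolynomial (Fin d) ℝ) :
    sphInt d f = ∫ x, restrictSph d f x ∂sphMeasure d := rfl

/-- Both sides obey the Leibniz rule in `f`, so the claim reduces to the variables. -/
lemma hasDerivAt_eval_planeRot {d : ℕ} {i j : Fin d} (hij : i ≠ j)
    (f : MvPolynomial (Fin d) ℝ) (x : EuclideanSpace ℝ (Fin d)) (t : ℝ) :
    HasDerivAt (fun t => MvPolynomial.eval (fun k => planeRot hij t x k) f)
      (MvPolynomial.eval (fun k => planeRot hij t x k) (infRot i j f)) t := by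
  induction f using MvPolynomial.induction_on with
  | C a => simpa [infRot_apply] using hasDerivAt_const t a
  | add p q hp hq =>
    simp only [map_add]
    exact hp.add hq
  | mul_X p k hp =>
    simp only [map_mul, MvPolynomial.eval_X, Derivation.leibniz, smul_eq_mul, map_add]
    have hX : HasDerivAt (fun t => planeRot hij t x k)
        (MvPolynomial.eval (fun k => planeRot hij t x k) (infRot i j (MvPolynomial.X k))) t := by
      simp only [planeRot_apply, planeRotLin_apply]
      have h := (((((Real.hasDerivAt_cos t).sub_const 1).mul_const (x i)).sub
        ((Real.hasDerivAt_sin t).mul_const (x j))).mul_const (if k = i then (1 : ℝ) else 0)).const_add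
          (x k) |>.add ((((Real.hasDerivAt_sin t).mul_const (x i)).add
        (((Real.hasDerivAt_cos t).sub_const 1).mul_const (x j))).mul_const
          (if k = j then (1 : ℝ) else 0))
      refine h.congr_deriv ?_
      by_cases hki : k = i
      · subst hki
        simp [infRot_apply, MvPolynomial.pderiv_X, hij, hij.symm]
        ring
      · by_cases hkj : k = j
        · subst hkj
          simp [infRot_apply, MvPolynomial.pderiv_X, hij, hij.symm]
          ring
        · simp [infRot_apply, MvPolynomial.pderiv_X, hki, hkj]
    refine (hp.mul hX).congr_deriv ?_
    ring

/-- Infinitesimal rotations integrate to zero over the sphere. -/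
lemma sphInt_infRot {d : ℕ} (i j : Fin d) (f : MvPolynomial (Fin d) ℝ) :
    sphInt d (infRot i j f) = 0 := by
  by_cases hij : i = j
  · subst hij
    simp [infRot_apply]
  have hd (t : ℝ) (x : Sph d) :
      HasDerivAt (fun t => restrictSph d f (sphMap (planeRot hij t) x))
        (restrictSph d (infRot i j f) (sphMap (planeRot hij t) x)) t := by
    simp only [restrictSph_apply]
    exact hasDerivAt_eval_planeRot hij f x t
  -- Rotated points stay on the sphere, so the sup norm of the derivative is a bound uniform in `t`.
  -- By invariance the differentiated integral is constant.
  have key := (hasDerivAt_integral_of_dominated_loc_of_deriv_le (μ := sphMeasure d) (𝕜 := ℝ)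
    (F := fun t x => restrictSph d f (sphMap (planeRot hij t) x))
    (F' := fun t x => restrictSph d (infRot i j f) (sphMap (planeRot hij t) x)) (x₀ := (0 : ℝ))
    (s := Set.univ) (bound := fun _ => ‖restrictSph d (infRot i j f)‖) Filter.univ_mem
    (Eventually.of_forall fun t => Continuous.aestronglyMeasurable (by fun_prop))
    (Continuous.integrable_of_hasCompactSupport (by fun_prop)
      (HasCompactSupport.of_compactSpace _))
    (Continuous.aestronglyMeasurable (by fun_prop))
    (Eventually.of_forall fun x t _ => ContinuousMap.norm_coe_le_norm _ _)
    (integrable_const _)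
    (Eventually.of_forall fun x t _ => hd t x)).2
  simp only [integral_comp_sphMap] at key
  exact key.unique (hasDerivAt_const _ _)

/-! ### The Laplacian on the sphere and orthogonality of harmonics -/

section

open MvPolynomial

/-- The polynomial `x_1^2 + ⋯ + x_d^2`. -/
def normSqPoly (d : ℕ) : MvPolynomial (Fin d) ℝ := ∑ i, X i ^ 2

lemma laplacian_apply {d : ℕ} (f : MvPolynomial (Fin d) ℝ) :
    laplacian d f = ∑ i, pderiv i (pderiv i f) := by
  simp [laplacian, LinearMap.sum_apply]

/-- The last term corrects the diagonal, where the left side is zero; the formula can then be summed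
over all pairs. -/
lemma infRot_infRot {d : ℕ} (i j : Fin d) (f : MvPolynomial (Fin d) ℝ) :
    infRot i j (infRot i j f) =
      X i ^ 2 * pderiv j (pderiv j f) + X j ^ 2 * pderiv i (pderiv i f)
      - X j * (X i * pderiv j (pderiv i f)) - X i * (X j * pderiv i (pderiv j f))
      - X i * pderiv i f - X j * pderiv j f
      + if i = j then X i * pderiv j f + X j * pderiv i f else 0 := by
  by_cases h : i = j
  · subst h
    simp only [infRot_apply, sub_self, map_zero, if_true]
    ring
  · simp only [infRot_apply, map_sub, Derivation.leibniz, smul_eq_mul, pderiv_X_self,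
      pderiv_X_of_ne h, pderiv_X_of_ne (Ne.symm h), if_neg h]
    ring

/-- On homogeneous polynomials, the sum of the squared infinitesimal rotations is
`2 (|x|² Δ - k (k + d - 2))`. -/
lemma sum_infRot_infRot {d k : ℕ} {f : MvPolynomial (Fin d) ℝ} (hf : f.IsHomogeneous k) :
    ∑ i, ∑ j, infRot i j (infRot i j f) =
      2 * (normSqPoly d * laplacian d f - C (eig d k) * f) := by
  have e1 : ∑ i, X i * pderiv i f = C (k : ℝ) * f := by
    rw [hf.sum_X_mul_pderiv, nsmul_eq_mul]
    simp
  -- Second-order Euler identity: apply the Euler operator twice and subtract the diagonal terms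
  -- produced by differentiating `X j`.
  have e2 : ∑ i, ∑ j, X i * (X j * pderiv i (pderiv j f)) = C ((k : ℝ) * k - k) * f := by
    have h : ∑ i, X i * pderiv i (∑ j, X j * pderiv j f) = C ((k : ℝ) * k) * f := by
      simp only [e1, pderiv_C_mul, mul_left_comm (X _) (C _)]
      rw [← Finset.mul_sum, e1, C_mul, mul_assoc]
    have h2 : ∀ i j : Fin d, X i * pderiv i (X j * pderiv j f) =
        X i * (X j * pderiv i (pderiv j f)) + if i = j then X i * pderiv i f else 0 := by
      intro i j
      by_cases hij : i = j
      · subst hij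
        simp [Derivation.leibniz]
        ring
      · simp [Derivation.leibniz, pderiv_X_of_ne (Ne.symm hij), hij]
    simp only [map_sum, Finset.mul_sum] at h
    simp only [h2, Finset.sum_add_distrib, Finset.sum_ite_eq, Finset.mem_univ, if_true, e1] at h
    rw [C_sub, sub_mul, ← h]
    ring
  have e3 : ∑ i : Fin d, ∑ j : Fin d, X i ^ 2 * pderiv j (pderiv j f) =
      normSqPoly d * laplacian d f := by
    rw [normSqPoly, laplacian_apply, Finset.sum_mul_sum]
  have e3' : ∑ i : Fin d, ∑ j : Fin d, X j ^ 2 * pderiv i (pderiv i f) =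
      normSqPoly d * laplacian d f := by
    rw [Finset.sum_comm, e3]
  have e2' : ∑ i, ∑ j, X j * (X i * pderiv j (pderiv i f)) = C ((k : ℝ) * k - k) * f := by
    rw [Finset.sum_comm, e2]
  simp only [infRot_infRot, Finset.sum_add_distrib, Finset.sum_sub_distrib, e2, e2', e3, e3',
    Finset.sum_ite_eq, Finset.mem_univ, if_true, e1, Finset.sum_const, Finset.card_univ,
    Fintype.card_fin, nsmul_eq_mul]
  rw [← Finset.mul_sum, e1]
  simp only [eig, C_sub, C_mul, C_add, map_natCast, map_ofNat]
  ring

lemma restrictSph_mul {d : ℕ} (f g : MvPolynomial (Fin d) ℝ) :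
    restrictSph d (f * g) = restrictSph d f * restrictSph d g := by
  simp [restrictSph]

lemma restrictSph_normSqPoly (d : ℕ) : restrictSph d (normSqPoly d) = 1 := by
  ext x
  have h : ‖(x : EuclideanSpace ℝ (Fin d))‖ ^ 2 = 1 := by simp
  rw [EuclideanSpace.norm_sq_eq] at h
  simpa [restrictSph_apply, normSqPoly] using h

lemma sphInt_normSqPoly_mul {d : ℕ} (f : MvPolynomial (Fin d) ℝ) :
    sphInt d (normSqPoly d * f) = sphInt d f := by
  rw [sphInt_apply, restrictSph_mul, restrictSph_normSqPoly, one_mul, sphInt_apply]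

/-- Integrating the sum of squared rotations gives zero, and `|x|² = 1` on the sphere. -/
lemma sphInt_laplacian {d k : ℕ} {f : MvPolynomial (Fin d) ℝ} (hf : f.IsHomogeneous k) :
    sphInt d (laplacian d f) = eig d k * sphInt d f := by
  have h := congrArg (sphInt d) (sum_infRot_infRot hf)
  simp only [map_sum, sphInt_infRot, Finset.sum_const_zero] at h
  rw [two_mul, map_add, map_sub, sphInt_normSqPoly_mul, ← smul_eq_C_mul, map_smul,
    smul_eq_mul] at h
  linarith

lemma laplacian_mul {d : ℕ} (p q : MvPolynomial (Fin d) ℝ) :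
    laplacian d (p * q) = laplacian d p * q + 2 * ∑ i, pderiv i p * pderiv i q
      + p * laplacian d q := by
  simp only [laplacian_apply, Derivation.leibniz, smul_eq_mul, map_add, Finset.mul_sum,
    Finset.sum_mul, ← Finset.sum_add_distrib]
  exact Finset.sum_congr rfl fun i _ => by ring

lemma mem_harmonicPoly {d n : ℕ} {p : MvPolynomial (Fin d) ℝ} :
    p ∈ harmonicPoly d n ↔ p.IsHomogeneous n ∧ laplacian d p = 0 := by
  simp [harmonicPoly, mem_homogeneousSubmodule]

lemma isHomogeneous_laplacian {d n : ℕ} {p : MvPolynomial (Fin d) ℝ} (hp : p.IsHomogeneous n) :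
    (laplacian d p).IsHomogeneous (n - 2) := by
  rw [laplacian_apply]
  exact IsHomogeneous.sum _ _ _ fun i _ => hp.pderiv.pderiv

/-- The commutator of two derivations is a derivation, and this one kills the variables. -/
lemma pderiv_pderiv_comm {d : ℕ} (i j : Fin d) (p : MvPolynomial (Fin d) ℝ) :
    pderiv i (pderiv j p) = pderiv j (pderiv i p) := by
  let D (i : Fin d) : Derivation ℝ (MvPolynomial (Fin d) ℝ) (MvPolynomial (Fin d) ℝ) := pderiv i
  have h : ⁅D i, D j⁆ = 0 := by
    refine derivation_ext fun k => ?_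
    simp only [D, Derivation.commutator_apply, pderiv_X, Pi.single_apply, Derivation.coe_zero,
      Pi.zero_apply]
    split_ifs <;> simp
  have h2 := congrArg (fun E => E p) h
  simpa only [Derivation.commutator_apply, Derivation.coe_zero, Pi.zero_apply,
    sub_eq_zero] using h2

lemma laplacian_pderiv {d : ℕ} (i : Fin d) (p : MvPolynomial (Fin d) ℝ) :
    laplacian d (pderiv i p) = pderiv i (laplacian d p) := by
  simp only [laplacian_apply, map_sum]
  refine Finset.sum_congr rfl fun j _ => ?_
  rw [pderiv_pderiv_comm j i p, pderiv_pderiv_comm j i]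

lemma pderiv_mem_harmonicPoly {d n : ℕ} {p : MvPolynomial (Fin d) ℝ} (i : Fin d)
    (hp : p ∈ harmonicPoly d n) : pderiv i p ∈ harmonicPoly d (n - 1) := by
  rw [mem_harmonicPoly] at hp ⊢
  exact ⟨hp.1.pderiv, by rw [laplacian_pderiv, hp.2, map_zero]⟩

lemma eig_pos {d n : ℕ} (hd : 2 ≤ d) (hn : 0 < n) : 0 < eig d n := by
  have h1 : (2 : ℝ) ≤ d := by exact_mod_cast hd
  have h2 : (0 : ℝ) < n := by exact_mod_cast hn
  exact mul_pos h2 (by linarith)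

/-- A harmonic homogeneous polynomial is orthogonal to all homogeneous polynomials of lower
degree. -/
lemma sphInt_mul_eq_zero {d : ℕ} (hd : 2 ≤ d) (j : ℕ) : ∀ {n : ℕ} {p q : MvPolynomial (Fin d) ℝ},
    p ∈ harmonicPoly d n → q.IsHomogeneous j → j < n → sphInt d (p * q) = 0 := by
  induction j using Nat.strong_induction_on with
  | _ j ih =>
    intro n p q hp hq hjn
    -- As `Δp = 0`, the Laplacian of `p q` consists of products of harmonics with polynomials of
    -- degree `j - 1` or `j - 2`, which integrate to zero by induction. The eigenvalue on the other
    -- side is positive. For `j = 0` the truncated subtraction gives no descent, but `q` is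
    -- constant.
    have h := sphInt_laplacian ((mem_harmonicPoly.1 hp).1.mul hq)
    rw [laplacian_mul, (mem_harmonicPoly.1 hp).2, zero_mul, zero_add, map_add, two_mul, map_add,
      map_sum] at h
    have h1 : ∀ i, sphInt d (pderiv i p * pderiv i q) = 0 := by
      intro i
      rcases Nat.eq_zero_or_pos j with rfl | hj
      · rw [← totalDegree_zero_iff_isHomogeneous, totalDegree_eq_zero_iff_eq_C] at hq
        rw [hq, pderiv_C, mul_zero, map_zero]
      · exact ih (j - 1) (by omega) (pderiv_mem_harmonicPoly i hp) hq.pderiv (by omega)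
    have h2 : sphInt d (p * laplacian d q) = 0 := by
      rcases Nat.eq_zero_or_pos j with rfl | hj
      · rw [← totalDegree_zero_iff_isHomogeneous, totalDegree_eq_zero_iff_eq_C] at hq
        rw [hq, laplacian_apply]
        simp
      · exact ih (j - 2) (by omega) hp (isHomogeneous_laplacian hq) (by omega)
    simp only [h1, h2, Finset.sum_const_zero, add_zero] at h
    exact (mul_eq_zero.1 h.symm).resolve_left (eig_pos hd (by omega)).ne'

lemma sphInt_mul_harmonic_eq_zero {d n k : ℕ} (hd : 2 ≤ d) {p q : MvPolynomial (Fin d) ℝ}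
    (hp : p ∈ harmonicPoly d n) (hq : q ∈ harmonicPoly d k) (hnk : n ≠ k) :
    sphInt d (p * q) = 0 := by
  rcases lt_or_gt_of_ne hnk with h | h
  · rw [mul_comm]
    exact sphInt_mul_eq_zero hd n hq (mem_harmonicPoly.1 hp).1 h
  · exact sphInt_mul_eq_zero hd k hp (mem_harmonicPoly.1 hq).1 h

lemma continuousMap_eq_zero_of_integral_sq {d : ℕ} {f : C(Sph d, ℝ)}
    (h : ∫ x, f x * f x ∂sphMeasure d = 0) : f = 0 := by
  have h0 : 0 ≤ fun x => f x * f x := fun x => mul_self_nonneg _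
  have hc : Continuous fun x => f x * f x := by fun_prop
  rw [integral_eq_zero_iff_of_nonneg h0 (hc.integrable_of_hasCompactSupport
    (HasCompactSupport.of_compactSpace _)), hc.ae_eq_iff_eq _ continuous_zero] at h
  ext x
  exact mul_self_eq_zero.1 (congrFun h x)

lemma eval_smul_of_isHomogeneous {d n : ℕ} {p : MvPolynomial (Fin d) ℝ}
    (hp : p.IsHomogeneous n) (c : ℝ) (r : Fin d → ℝ) :
    eval (c • r) p = c ^ n * eval r p := by
  rw [eval_eq, eval_eq, Finset.mul_sum]
  refine Finset.sum_congr rfl fun s hs => ?_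
  simp only [Pi.smul_apply, smul_eq_mul, mul_pow, Finset.prod_mul_distrib]
  rw [Finset.prod_pow_eq_pow_sum, ← hp.degree_eq_sum_deg_support hs]
  ring

lemma eq_zero_of_restrictSph_eq_zero {d n : ℕ} (hd : 1 ≤ d) {p : MvPolynomial (Fin d) ℝ}
    (hp : p.IsHomogeneous n) (h : restrictSph d p = 0) : p = 0 := by
  refine hp.eq_zero_of_forall_eval_eq_zero fun r => ?_
  have hu : ∃ u : Sph d, r = ‖WithLp.toLp 2 r‖ • fun i => (u : EuclideanSpace ℝ (Fin d)) i := by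
    by_cases hr : WithLp.toLp 2 r = 0
    · refine ⟨⟨EuclideanSpace.single ⟨0, hd⟩ 1, by simp⟩, ?_⟩
      rw [hr]
      simpa using hr
    · refine ⟨⟨‖WithLp.toLp 2 r‖⁻¹ • WithLp.toLp 2 r, ?_⟩, ?_⟩
      · simp [norm_smul, norm_ne_zero_iff.2 hr]
      · ext i
        simp [mul_inv_cancel_left₀ (norm_ne_zero_iff.2 hr)]
  obtain ⟨u, hu⟩ := hu
  rw [hu, eval_smul_of_isHomogeneous hp, ← restrictSph_apply, h]
  simp

lemma restrictSph_eq_zero_of_sphInt {d : ℕ} {p : MvPolynomial (Fin d) ℝ}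
    (h : sphInt d (p * p) = 0) : restrictSph d p = 0 := by
  refine continuousMap_eq_zero_of_integral_sq ?_
  rw [sphInt_apply, restrictSph_mul] at h
  exact h

/-! ### Decomposition of polynomials into harmonics on the sphere -/

lemma isHomogeneous_normSqPoly (d : ℕ) : (normSqPoly d).IsHomogeneous 2 :=
  IsHomogeneous.sum _ _ _ fun i _ => isHomogeneous_X_pow i 2

/-- `q ↦ Δ (|x|² q)` is injective on homogeneous polynomials. -/
lemma eq_zero_of_laplacian_normSqPoly_mul {d n : ℕ} (hd : 2 ≤ d) {q : MvPolynomial (Fin d) ℝ}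
    (hq : q.IsHomogeneous n) (h : laplacian d (normSqPoly d * q) = 0) : q = 0 := by
  have hp : normSqPoly d * q ∈ harmonicPoly d (2 + n) :=
    mem_harmonicPoly.2 ⟨(isHomogeneous_normSqPoly d).mul hq, h⟩
  -- A harmonic `|x|² q` is orthogonal to `q`, of lower degree; on the sphere this reads `∫ q² = 0`.
  have h1 := sphInt_mul_eq_zero hd n hp hq (by omega)
  rw [mul_assoc, sphInt_normSqPoly_mul] at h1
  exact eq_zero_of_restrictSph_eq_zero (by omega) hq (restrictSph_eq_zero_of_sphInt h1)

/-- An injective endomorphism of the finite-dimensional space of homogeneous polynomials is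
surjective. -/
lemma exists_laplacian_normSqPoly_mul {d n : ℕ} (hd : 2 ≤ d) {p : MvPolynomial (Fin d) ℝ}
    (hp : p.IsHomogeneous n) :
    ∃ q : MvPolynomial (Fin d) ℝ, q.IsHomogeneous n ∧ laplacian d (normSqPoly d * q) = p := by
  let V := homogeneousSubmodule (Fin d) ℝ n
  have : FiniteDimensional ℝ V := Module.Finite.iff_fg.2 (homogeneousSubmodule_fg _ _ n)
  let T : V →ₗ[ℝ] V := (laplacian d ∘ₗ LinearMap.mulLeft ℝ (normSqPoly d)).restrict
    (p := V) (q := V) (fun q hq => by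
      have h := isHomogeneous_laplacian ((isHomogeneous_normSqPoly d).mul hq)
      rwa [Nat.add_sub_cancel_left] at h)
  have hT : Function.Injective T := by
    rw [← LinearMap.ker_eq_bot, LinearMap.ker_eq_bot']
    intro q hq
    exact Subtype.ext (eq_zero_of_laplacian_normSqPoly_mul hd q.2 (congrArg Subtype.val hq))
  obtain ⟨q, hq⟩ := (LinearMap.injective_iff_surjective.1 hT) ⟨p, hp⟩
  exact ⟨q, q.2, congrArg Subtype.val hq⟩

/-- On the sphere, a homogeneous polynomial of degree `n` is a sum of spherical harmonics of
degree at most `n`. -/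
lemma restrictSph_mem_iSup {d : ℕ} (hd : 2 ≤ d) (n : ℕ) : ∀ {p : MvPolynomial (Fin d) ℝ},
    p.IsHomogeneous n →
      restrictSph d p ∈ ⨆ j ∈ Set.Iic n, (harmonicPoly d j).map (restrictSph d) := by
  induction n using Nat.strong_induction_on with
  | _ n ih =>
    intro p hp
    have hle : (harmonicPoly d n).map (restrictSph d) ≤
        ⨆ j ∈ Set.Iic n, (harmonicPoly d j).map (restrictSph d) :=
      le_biSup (fun j => (harmonicPoly d j).map (restrictSph d)) (Set.mem_Iic.2 le_rfl)
    rcases Nat.lt_or_ge n 2 with hn | hn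
    · refine hle (Submodule.mem_map_of_mem (mem_harmonicPoly.2 ⟨hp, ?_⟩))
      rw [laplacian_apply]
      refine Finset.sum_eq_zero fun i _ => ?_
      have h0 : (pderiv i p).IsHomogeneous 0 := by
        have h := hp.pderiv (i := i)
        rwa [show n - 1 = 0 by omega] at h
      rw [← totalDegree_zero_iff_isHomogeneous, totalDegree_eq_zero_iff_eq_C] at h0
      rw [h0, pderiv_C]
    -- With `Δ(|x|² q) = Δp`, the difference `p - |x|² q` is harmonic, while `|x|² q` agrees on the
    -- sphere with `q`, of degree `n - 2`.
    · obtain ⟨q, hq, hpq⟩ := exists_laplacian_normSqPoly_mul hd (isHomogeneous_laplacian hp)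
      have h2 : (normSqPoly d * q).IsHomogeneous n := by
        have h := (isHomogeneous_normSqPoly d).mul hq
        rwa [Nat.add_sub_cancel' hn] at h
      have hr : restrictSph d p = restrictSph d (p - normSqPoly d * q) + restrictSph d q := by
        rw [map_sub, restrictSph_mul, restrictSph_normSqPoly, one_mul, sub_add_cancel]
      rw [hr]
      refine add_mem (hle (Submodule.mem_map_of_mem (mem_harmonicPoly.2 ⟨hp.sub h2, ?_⟩)))
        (SetLike.le_def.1 (biSup_mono fun j hj => ?_) (ih (n - 2) (by omega) hq))
      · rw [map_sub, hpq, sub_self]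
      · exact Set.mem_Iic.2 (le_trans hj (Nat.sub_le _ _))

lemma restrictSph_mem_iSup_of_totalDegree_le {d n : ℕ} (hd : 2 ≤ d)
    {p : MvPolynomial (Fin d) ℝ} (hp : p.totalDegree ≤ n) :
    restrictSph d p ∈ ⨆ j ∈ Set.Iic n, (harmonicPoly d j).map (restrictSph d) := by
  rw [← sum_homogeneousComponent p, map_sum]
  refine sum_mem fun j hj => SetLike.le_def.1 (biSup_mono fun i hi => ?_)
    (restrictSph_mem_iSup hd j (homogeneousComponent_isHomogeneous j p))
  have := Finset.mem_range.1 hj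
  exact Set.mem_Iic.2 (le_trans hi (by omega))

/-! ### Integrals of harmonics against powers of a linear form -/

/-- The linear form `x ↦ ⟨x, y⟩`. -/
def linForm {d : ℕ} (y : Fin d → ℝ) : MvPolynomial (Fin d) ℝ := ∑ i, C (y i) * X i

lemma isHomogeneous_linForm {d : ℕ} (y : Fin d → ℝ) : (linForm y).IsHomogeneous 1 :=
  IsHomogeneous.sum _ _ _ fun i _ => isHomogeneous_C_mul_X _ i

lemma pderiv_linForm {d : ℕ} (y : Fin d → ℝ) (i : Fin d) : pderiv i (linForm y) = C (y i) := by
  simp [linForm, pderiv_X, Pi.single_apply]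

/-- The constants `c` with `∫ p(x) (x·y)^n dσ(x) = c p(y)` for harmonic homogeneous polynomials
`p` of degree `n`. -/
def linFormConst (d : ℕ) : ℕ → ℝ
  | 0 => 1
  | n + 1 => 2 * (n + 1) ^ 2 * linFormConst d n / eig d (2 * (n + 1))

lemma sphInt_mul_linForm_pow {d : ℕ} (hd : 2 ≤ d) (y : Fin d → ℝ) (n : ℕ) :
    ∀ {p : MvPolynomial (Fin d) ℝ}, p ∈ harmonicPoly d n →
      sphInt d (p * linForm y ^ n) = linFormConst d n * eval y p := by
  induction n with
  | zero =>
    intro p hp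
    have hp := (mem_harmonicPoly.1 hp).1
    rw [← totalDegree_zero_iff_isHomogeneous, totalDegree_eq_zero_iff_eq_C] at hp
    have := sphMeasure_isProbability (d := d) (by omega)
    rw [hp, sphInt_apply]
    simp [restrictSph_apply, linFormConst]
  | succ n ih =>
    intro p hp
    -- The product has degree `2 (n + 1)`. In its Laplacian only the gradient term survives
    -- integration: one factor `n + 1` comes from the power, another from Euler's identity at `y`.
    -- This is the recursion of `linFormConst`.
    have h := sphInt_laplacian ((mem_harmonicPoly.1 hp).1.mul
      ((isHomogeneous_linForm y).pow (n + 1)))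
    rw [laplacian_mul, (mem_harmonicPoly.1 hp).2, zero_mul, zero_add, map_add, two_mul, map_add,
      map_sum] at h
    have h1 : ∀ i, sphInt d (pderiv i p * pderiv i (linForm y ^ (n + 1))) =
        (n + 1) * linFormConst d n * (y i * eval y (pderiv i p)) := by
      intro i
      have e : pderiv i p * pderiv i (linForm y ^ (n + 1)) =
          C ((n + 1) * y i) * (pderiv i p * linForm y ^ n) := by
        rw [pderiv_pow, pderiv_linForm]
        simp
        ring
      rw [e, ← smul_eq_C_mul, map_smul, ih (pderiv_mem_harmonicPoly i hp), smul_eq_mul]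
      ring
    have h2 : sphInt d (p * laplacian d (linForm y ^ (n + 1))) = 0 := by
      refine sphInt_mul_eq_zero hd _ hp
        (isHomogeneous_laplacian ((isHomogeneous_linForm y).pow (n + 1))) (by omega)
    have h3 : ∑ i, y i * eval y (pderiv i p) = (n + 1) * eval y p := by
      have h := congrArg (eval y) (mem_harmonicPoly.1 hp).1.sum_X_mul_pderiv
      simpa using h
    simp only [h1, h2, add_zero, ← Finset.mul_sum, h3] at h
    have h4 := eig_pos hd (n := 2 * (n + 1)) (by omega)
    rw [linFormConst, div_mul_eq_mul_div, eq_div_iff h4.ne']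
    rw [show n + 1 + 1 * (n + 1) = 2 * (n + 1) by ring] at h
    linarith

end

/-! ### Gegenbauer polynomials and zonal functions -/

section

open MvPolynomial

/-- The hypergeometric polynomial `₂F₁(-n, b; c; X)`. -/
def hypPoly (n : ℕ) (b c : ℝ) : Polynomial ℝ :=
  ∑ k ∈ Finset.range (n + 1),
    Polynomial.monomial k (ordinaryHypergeometricCoefficient (-(n : ℝ)) b c k)

lemma ordinaryHypergeometricCoefficient_eq_zero {n k : ℕ} (b c : ℝ) (h : n < k) :
    ordinaryHypergeometricCoefficient (-(n : ℝ)) b c k = 0 := by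
  simp [ordinaryHypergeometricCoefficient,
    (ascPochhammer_eval_eq_zero_iff k (-(n : ℝ))).2 ⟨n, h, by simp⟩]

lemma coeff_hypPoly (n : ℕ) (b c : ℝ) (k : ℕ) :
    (hypPoly n b c).coeff k = ordinaryHypergeometricCoefficient (-(n : ℝ)) b c k := by
  simp only [hypPoly, Polynomial.finsetSum_coeff, Polynomial.coeff_monomial,
    Finset.sum_ite_eq', Finset.mem_range]
  split_ifs with h
  · rfl
  · exact (ordinaryHypergeometricCoefficient_eq_zero b c (by omega)).symm

lemma natDegree_hypPoly_le (n : ℕ) (b c : ℝ) : (hypPoly n b c).natDegree ≤ n := by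
  refine Polynomial.natDegree_le_iff_coeff_eq_zero.2 fun k hk => ?_
  rw [coeff_hypPoly, ordinaryHypergeometricCoefficient_eq_zero b c hk]

lemma eval_hypPoly (n : ℕ) (b c x : ℝ) :
    (hypPoly n b c).eval x = ordinaryHypergeometric (-(n : ℝ)) b c x := by
  rw [ordinaryHypergeometric_eq_tsum]
  beta_reduce
  rw [tsum_eq_sum (s := Finset.range (n + 1))]
  · simp [hypPoly, Polynomial.eval_finsetSum]
  · intro k hk
    have h := ordinaryHypergeometricCoefficient_eq_zero b c (n := n) (k := k)
      (by simpa using hk)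
    rw [ordinaryHypergeometricCoefficient] at h
    rw [h, zero_smul]

lemma ordinaryHypergeometricCoefficient_succ (a b c : ℝ) (hc : 0 < c) (k : ℕ) :
    ordinaryHypergeometricCoefficient a b c (k + 1) * ((k + 1) * (c + k)) =
      ordinaryHypergeometricCoefficient a b c k * ((a + k) * (b + k)) := by
  have h1 : (c + k) ≠ 0 := by positivity
  have h2 : ((k : ℝ) + 1) ≠ 0 := by positivity
  have h3 : ((k.factorial : ℕ) : ℝ) ≠ 0 := by exact_mod_cast k.factorial_ne_zero
  have h4 : (ascPochhammer ℝ k).eval c ≠ 0 := (ascPochhammer_pos k c hc).ne'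
  simp only [ordinaryHypergeometricCoefficient, ascPochhammer_succ_eval, Nat.factorial_succ]
  push_cast
  field_simp

/-- The hypergeometric differential equation. -/
lemma hypPoly_ode (n : ℕ) (b c : ℝ) (hc : 0 < c) :
    Polynomial.X * (1 - Polynomial.X) *
        Polynomial.derivative (Polynomial.derivative (hypPoly n b c))
      + (Polynomial.C c - Polynomial.C (-(n : ℝ) + b + 1) * Polynomial.X) *
        Polynomial.derivative (hypPoly n b c)
      = Polynomial.C (-(n : ℝ) * b) * hypPoly n b c := by
  set u := hypPoly n b c with hu
  have hrec (k : ℕ) : u.coeff (k + 1) * ((k + 1) * (c + k)) =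
      u.coeff k * ((-(n : ℝ) + k) * (b + k)) := by
    simp only [hu, coeff_hypPoly]
    exact ordinaryHypergeometricCoefficient_succ _ _ _ hc k
  generalize hg : -(n : ℝ) + b + 1 = g
  generalize he : -(n : ℝ) * b = e
  have hsplit : Polynomial.X * (1 - Polynomial.X) * Polynomial.derivative (Polynomial.derivative u)
      + (Polynomial.C c - Polynomial.C g * Polynomial.X) * Polynomial.derivative u =
      Polynomial.X * Polynomial.derivative (Polynomial.derivative u)
      - Polynomial.X * (Polynomial.X * Polynomial.derivative (Polynomial.derivative u))
      + Polynomial.C c * Polynomial.derivative u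
      - Polynomial.C g * (Polynomial.X * Polynomial.derivative u) := by ring
  rw [hsplit]
  ext k
  have hk := hrec k
  simp only [Polynomial.coeff_add, Polynomial.coeff_sub, Polynomial.coeff_C_mul]
  -- Up to two factors `X` shift the coefficients, so degrees `0` and `1` are separate; each case is
  -- the recursion `hrec`.
  rcases k with _ | _ | k
  · simp only [Polynomial.mul_coeff_zero, Polynomial.coeff_X_zero, zero_mul,
      Polynomial.coeff_derivative]
    push_cast at hk ⊢
    rw [← he]
    linarith
  · simp only [Polynomial.coeff_X_mul, Polynomial.mul_coeff_zero, Polynomial.coeff_X_zero, zero_mul,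
      Polynomial.coeff_derivative]
    push_cast at hk ⊢
    rw [← he, ← hg]
    linarith
  · simp only [Polynomial.coeff_X_mul, Polynomial.coeff_derivative]
    push_cast at hk ⊢
    rw [← he, ← hg]
    linarith

/-- The normalized Gegenbauer polynomial of degree `n` of the sphere `S^{d-1}`. -/
def gegPoly (d n : ℕ) : Polynomial ℝ :=
  (hypPoly n ((n : ℝ) + 2 * (((d : ℝ) - 2) / 2)) (((d : ℝ) - 2) / 2 + 1 / 2)).comp
    (Polynomial.C (1 / 2) * (1 - Polynomial.X))

lemma eval_gegPoly (d n : ℕ) (t : ℝ) :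
    (gegPoly d n).eval t = gegenbauerW (((d : ℝ) - 2) / 2) n t := by
  rw [gegPoly, Polynomial.eval_comp, eval_hypPoly, gegenbauerW]
  congr 1
  simp
  ring

lemma natDegree_gegPoly_le (d n : ℕ) : (gegPoly d n).natDegree ≤ n := by
  refine (Polynomial.natDegree_comp_le).trans ?_
  refine (Nat.mul_le_mul (natDegree_hypPoly_le n _ _) (?_ : _ ≤ 1)).trans (by simp)
  refine (Polynomial.natDegree_C_mul_le _ _).trans ((Polynomial.natDegree_sub_le _ _).trans ?_)
  simp

lemma gegenbauerW_one (lam : ℝ) (n : ℕ) : gegenbauerW lam n 1 = 1 := by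
  simp [gegenbauerW]

/-- The zonal polynomial `x ↦ W_n(x·y)`. -/
def zonalPoly {d : ℕ} (n : ℕ) (y : Fin d → ℝ) : MvPolynomial (Fin d) ℝ :=
  Polynomial.aeval (linForm y) (gegPoly d n)

lemma eval_linForm {d : ℕ} (x y : Fin d → ℝ) : eval x (linForm y) = ∑ i, y i * x i := by
  simp [linForm]

lemma restrictSph_zonalPoly {d : ℕ} (n : ℕ) (x y : Sph d) :
    restrictSph d (zonalPoly n fun i => (y : EuclideanSpace ℝ (Fin d)) i) x =
      gegenbauerW (((d : ℝ) - 2) / 2) n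
        (inner ℝ (x : EuclideanSpace ℝ (Fin d)) (y : EuclideanSpace ℝ (Fin d))) := by
  rw [restrictSph_apply, zonalPoly, ← eval_gegPoly]
  have h : eval (fun i => (x : EuclideanSpace ℝ (Fin d)) i)
      (linForm fun i => (y : EuclideanSpace ℝ (Fin d)) i) =
      inner ℝ (x : EuclideanSpace ℝ (Fin d)) (y : EuclideanSpace ℝ (Fin d)) := by
    rw [eval_linForm, PiLp.inner_apply]
    simp
  rw [← h, Polynomial.aeval_def, Polynomial.hom_eval₂, Polynomial.eval, Polynomial.eval₂_eq_sum,
    Polynomial.eval₂_eq_sum]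
  simp [Polynomial.sum, algebraMap_eq]

lemma totalDegree_zonalPoly_le {d : ℕ} (n : ℕ) (y : Fin d → ℝ) :
    (zonalPoly n y).totalDegree ≤ n := by
  rw [zonalPoly, Polynomial.aeval_eq_sum_range' (n := n + 1)
    (Nat.lt_succ_of_le (natDegree_gegPoly_le d n))]
  refine totalDegree_finsetSum_le fun k hk => (totalDegree_smul_le _ _).trans ?_
  have h := ((isHomogeneous_linForm y).pow k).totalDegree_le
  have := Finset.mem_range.1 hk
  omega

/-- Only the top power of `W_n` contributes: lower powers of the linear form are orthogonal to `p`.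
-/
lemma sphInt_mul_zonalPoly {d n : ℕ} (hd : 2 ≤ d) {p : MvPolynomial (Fin d) ℝ}
    (hp : p ∈ harmonicPoly d n) (y : Fin d → ℝ) :
    sphInt d (p * zonalPoly n y) = (gegPoly d n).coeff n * linFormConst d n * eval y p := by
  rw [zonalPoly, Polynomial.aeval_eq_sum_range' (n := n + 1)
    (Nat.lt_succ_of_le (natDegree_gegPoly_le d n)), Finset.mul_sum, map_sum,
    Finset.sum_range_succ, Finset.sum_eq_zero, zero_add]
  · rw [mul_smul_comm, map_smul, sphInt_mul_linForm_pow hd y n hp, smul_eq_mul, mul_assoc]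
  · intro k hk
    have h := (isHomogeneous_linForm y).pow k
    rw [one_mul] at h
    rw [mul_smul_comm, map_smul, sphInt_mul_eq_zero hd k hp h (Finset.mem_range.1 hk), smul_zero]

/-- Integration by parts: the Leibniz rule and the vanishing integral of a rotated product. -/
lemma sphInt_infRot_mul {d : ℕ} (i j : Fin d) (f g : MvPolynomial (Fin d) ℝ) :
    sphInt d (infRot i j f * g) = - sphInt d (f * infRot i j g) := by
  have h := sphInt_infRot i j (f * g)
  rw [Derivation.leibniz, map_add, smul_eq_mul, smul_eq_mul, mul_comm g] at h
  linarith

lemma sphInt_infRot_infRot_mul {d : ℕ} (f g : MvPolynomial (Fin d) ℝ) :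
    sphInt d ((∑ i, ∑ j, infRot i j (infRot i j f)) * g) =
      sphInt d (f * ∑ i, ∑ j, infRot i j (infRot i j g)) := by
  simp only [Finset.sum_mul, Finset.mul_sum, map_sum]
  refine Finset.sum_congr rfl fun i _ => Finset.sum_congr rfl fun j _ => ?_
  rw [sphInt_infRot_mul, sphInt_infRot_mul, neg_neg]

lemma sum_infRot_infRot_linForm {d : ℕ} (y : Fin d → ℝ) :
    ∑ i, ∑ j, infRot i j (infRot i j (linForm y)) = C (-2 * ((d : ℝ) - 1)) * linForm y := by
  rw [sum_infRot_infRot (isHomogeneous_linForm y), laplacian_apply]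
  simp only [pderiv_linForm, pderiv_C, Finset.sum_const_zero, mul_zero, zero_sub, eig]
  simp only [C_mul, C_sub, C_add, C_neg, map_natCast, map_ofNat, map_one, Nat.cast_one]
  ring

lemma sum_infRot_linForm_sq {d : ℕ} (y : Fin d → ℝ) :
    ∑ i, ∑ j, infRot i j (linForm y) * infRot i j (linForm y) =
      2 * (normSqPoly d * C (∑ i, y i ^ 2) - linForm y ^ 2) := by
  have e (i j : Fin d) : infRot i j (linForm y) * infRot i j (linForm y) =
      X i ^ 2 * C (y j ^ 2) + C (y i ^ 2) * X j ^ 2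
        - (C (y i) * X i) * (C (y j) * X j) - (C (y i) * X i) * (C (y j) * X j) := by
    rw [infRot_apply, pderiv_linForm, pderiv_linForm, C_pow, C_pow]
    ring
  simp only [e, Finset.sum_add_distrib, Finset.sum_sub_distrib, ← Finset.sum_mul_sum, map_sum]
  rw [← normSqPoly, ← linForm]
  ring

/-- Write the zonal polynomial as `u(s)` with `s = (1 - x·y)/2`. The chain rule gives, on the
sphere, `2 (s (1 - s) u'' + c (1 - 2 s) u')` with `c = (d - 1)/2`, and the hypergeometric equation
turns this into `-2 n (n + d - 2) u`. The polynomial itself need not be homogeneous, so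
`sum_infRot_infRot` does not apply to it. -/
lemma restrictSph_sum_infRot_zonalPoly {d : ℕ} (hd : 2 ≤ d) (n : ℕ) (y : Sph d) :
    restrictSph d (∑ i, ∑ j, infRot i j (infRot i j
      (zonalPoly n fun i => (y : EuclideanSpace ℝ (Fin d)) i))) =
    (-2 * eig d n) • restrictSph d (zonalPoly n fun i => (y : EuclideanSpace ℝ (Fin d)) i) := by
  set v : Fin d → ℝ := fun i => (y : EuclideanSpace ℝ (Fin d)) i with hv
  have hv1 : ∑ i, v i ^ 2 = 1 := by
    have h : ‖(y : EuclideanSpace ℝ (Fin d))‖ ^ 2 = 1 := by simp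
    rw [EuclideanSpace.norm_sq_eq] at h
    simpa [hv] using h
  set c : ℝ := ((d : ℝ) - 2) / 2 + 1 / 2 with hc
  set b : ℝ := (n : ℝ) + 2 * (((d : ℝ) - 2) / 2) with hb
  have hc0 : 0 < c := by
    have : (2 : ℝ) ≤ d := by exact_mod_cast hd
    rw [hc]
    linarith
  set u := hypPoly n b c with hu
  set s : MvPolynomial (Fin d) ℝ := C (1 / 2) * (1 - linForm v) with hs
  have hz : zonalPoly n v = Polynomial.aeval s u := by
    rw [zonalPoly, gegPoly, Polynomial.aeval_comp, map_mul, map_sub, Polynomial.aeval_C,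
      Polynomial.aeval_X, map_one, algebraMap_eq]
  have hDs (i j : Fin d) : infRot i j s = C (-1 / 2) * infRot i j (linForm v) := by
    rw [hs, ← smul_eq_C_mul, Derivation.map_smul, map_sub, Derivation.map_one_eq_zero, zero_sub, smul_neg,
      smul_eq_C_mul, neg_div, C_neg, neg_mul]
  have hDD (i j : Fin d) : infRot i j (infRot i j (zonalPoly n v)) =
      Polynomial.aeval s (Polynomial.derivative (Polynomial.derivative u)) * C (1 / 4) *
        (infRot i j (linForm v) * infRot i j (linForm v))
      + Polynomial.aeval s (Polynomial.derivative u) * C (-1 / 2) *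
        infRot i j (infRot i j (linForm v)) := by
    rw [hz, Derivation.map_aeval, smul_eq_mul, Derivation.leibniz, Derivation.map_aeval, hDs,
      ← smul_eq_C_mul, Derivation.map_smul, smul_eq_C_mul]
    simp only [smul_eq_mul, smul_eq_C_mul]
    have h4 : (C (1 / 4) : MvPolynomial (Fin d) ℝ) = C (-1 / 2) * C (-1 / 2) := by
      rw [← C_mul]
      norm_num
    rw [h4]
    ring
  simp only [hDD, Finset.sum_add_distrib, ← Finset.mul_sum]
  rw [sum_infRot_linForm_sq, sum_infRot_infRot_linForm, hv1, C_1, mul_one]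
  have hode := congrArg (fun q => restrictSph d (Polynomial.aeval s q)) (hypPoly_ode n b c hc0)
  rw [← hu] at hode
  ext x
  have hode := congrArg (fun f => f x) hode
  have h1 : restrictSph d (normSqPoly d) x = 1 := by
    rw [restrictSph_normSqPoly]
    rfl
  simp only [restrictSph_apply, ContinuousMap.smul_apply, smul_eq_mul] at hode h1 ⊢
  simp only [hz, map_mul, map_add, map_sub, Polynomial.aeval_X, Polynomial.aeval_C, map_one,
    algebraMap_eq, eval_C, map_pow, map_ofNat] at hode h1 ⊢
  rw [h1]
  have hsL : eval (fun i => (x : EuclideanSpace ℝ (Fin d)) i) (linForm v) =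
      1 - 2 * eval (fun i => (x : EuclideanSpace ℝ (Fin d)) i) s := by
    simp [hs]
  rw [hsL]
  have hbe : eig d n = n * b := by
    rw [eig, hb]
    ring
  have hcd : (d : ℝ) - 1 = 2 * c := by
    rw [hc]
    ring
  have hbc : -(n : ℝ) + b + 1 = 2 * c := by
    rw [hc, hb]
    ring
  rw [hbc] at hode
  rw [hbe, hcd]
  linear_combination 2 * hode

end

/-! ### The addition theorem -/

section

open MvPolynomial

lemma toL2_injective (d : ℕ) : Function.Injective (toL2 d) :=
  ContinuousMap.toLp_injective (sphMeasure d)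

lemma inner_toL2 {d : ℕ} (f g : C(Sph d, ℝ)) :
    inner ℝ (toL2 d f) (toL2 d g) = ∫ x, f x * g x ∂sphMeasure d := by
  rw [ContinuousMap.inner_toLp]
  simp [mul_comm]

lemma inner_toL2_restrictSph {d : ℕ} (p q : MvPolynomial (Fin d) ℝ) :
    inner ℝ (toL2 d (restrictSph d p)) (toL2 d (restrictSph d q)) = sphInt d (p * q) := by
  rw [inner_toL2, sphInt_apply, restrictSph_mul]
  rfl

lemma exists_harmRep {d : ℕ} (Y : HarmBasis d) (n : ℕ) (j : Fin (dimHarm d n)) :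
    ∃ p ∈ harmonicPoly d n, toL2 d (restrictSph d p) = (Y n j : L2 d) := by
  obtain ⟨_, ⟨p, hp, rfl⟩, hf⟩ := (Y n j).2
  exact ⟨p, hp, hf⟩

/-- A harmonic polynomial that represents the basis element `Y_j^n`. -/
def harmRep {d : ℕ} (Y : HarmBasis d) (n : ℕ) (j : Fin (dimHarm d n)) : MvPolynomial (Fin d) ℝ :=
  (exists_harmRep Y n j).choose

lemma harmRep_mem {d : ℕ} (Y : HarmBasis d) (n : ℕ) (j : Fin (dimHarm d n)) :
    harmRep Y n j ∈ harmonicPoly d n := (exists_harmRep Y n j).choose_spec.1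

/-- The basis element `Y_j^n` as a continuous function. -/
def harmC {d : ℕ} (Y : HarmBasis d) (n : ℕ) (j : Fin (dimHarm d n)) : C(Sph d, ℝ) :=
  restrictSph d (harmRep Y n j)

lemma toL2_harmC {d : ℕ} (Y : HarmBasis d) (n : ℕ) (j : Fin (dimHarm d n)) :
    toL2 d (harmC Y n j) = (Y n j : L2 d) := (exists_harmRep Y n j).choose_spec.2

lemma fourierCoeff_toL2 {d : ℕ} (Y : HarmBasis d) (f : C(Sph d, ℝ)) (n : ℕ)
    (j : Fin (dimHarm d n)) :
    fourierCoeff Y (toL2 d f) n j = ∫ x, harmC Y n j x * f x ∂sphMeasure d := by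
  rw [fourierCoeff, ← toL2_harmC, inner_toL2]

lemma fourierCoeff_restrictSph {d : ℕ} (Y : HarmBasis d) (p : MvPolynomial (Fin d) ℝ) (n : ℕ)
    (j : Fin (dimHarm d n)) :
    fourierCoeff Y (toL2 d (restrictSph d p)) n j = sphInt d (harmRep Y n j * p) := by
  rw [fourierCoeff, ← toL2_harmC, harmC, inner_toL2_restrictSph]

lemma fourierCoeff_harmC_self {d : ℕ} (Y : HarmBasis d) (n : ℕ) (i j : Fin (dimHarm d n)) :
    fourierCoeff Y (toL2 d (harmC Y n j)) n i = if i = j then 1 else 0 := by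
  rw [toL2_harmC, fourierCoeff, ← Submodule.coe_inner]
  exact orthonormal_iff_ite.1 (Y n).orthonormal i j

lemma fourierCoeff_harmC_of_ne {d : ℕ} (hd : 2 ≤ d) (Y : HarmBasis d) {n k : ℕ} (h : n ≠ k)
    (i : Fin (dimHarm d n)) (j : Fin (dimHarm d k)) :
    fourierCoeff Y (toL2 d (harmC Y k j)) n i = 0 := by
  rw [harmC, fourierCoeff_restrictSph]
  exact sphInt_mul_harmonic_eq_zero hd (harmRep_mem Y n i) (harmRep_mem Y k j) h

lemma restrictSph_eq_sum_harmC {d n : ℕ} (Y : HarmBasis d) {p : MvPolynomial (Fin d) ℝ}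
    (hp : p ∈ harmonicPoly d n) :
    restrictSph d p = ∑ j, sphInt d (harmRep Y n j * p) • harmC Y n j := by
  apply toL2_injective
  have hmem : toL2 d (restrictSph d p) ∈ sphHarm d n :=
    Submodule.mem_map_of_mem (Submodule.mem_map_of_mem hp)
  have h := congrArg Subtype.val ((Y n).sum_repr' ⟨_, hmem⟩)
  rw [map_sum]
  refine h.symm.trans ?_
  simp only [Submodule.coe_sum, Submodule.coe_smul, Submodule.coe_inner, map_smul, toL2_harmC]
  refine Finset.sum_congr rfl fun j _ => ?_
  rw [← inner_toL2_restrictSph, ← harmC, toL2_harmC]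

lemma eig_injective {d n k : ℕ} (hd : 2 ≤ d) (h : eig d n = eig d k) : n = k := by
  have h1 : (2 : ℝ) ≤ d := by exact_mod_cast hd
  by_contra hne
  have hne' : (n : ℝ) - k ≠ 0 := sub_ne_zero.2 (by exact_mod_cast hne)
  have h2 : ((n : ℝ) - k) * (n + k + d - 2) = 0 := by
    simp only [eig] at h
    linarith
  have h3 := (mul_eq_zero.1 h2).resolve_left hne'
  have hn : (0 : ℝ) ≤ n := n.cast_nonneg
  have hk : (0 : ℝ) ≤ k := k.cast_nonneg
  have hn0 : (n : ℝ) = 0 := by linarith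
  have hk0 : (k : ℝ) = 0 := by linarith
  exact hne' (by rw [hn0, hk0, sub_zero])

/-- The sum of squared rotations is symmetric, and eigenfunctions with distinct eigenvalues are
orthogonal. -/
lemma sphInt_zonalPoly_mul_of_ne {d n k : ℕ} (hd : 2 ≤ d) (y : Sph d)
    {p : MvPolynomial (Fin d) ℝ} (hp : p ∈ harmonicPoly d k) (h : k ≠ n) :
    sphInt d (zonalPoly n (fun i => (y : EuclideanSpace ℝ (Fin d)) i) * p) = 0 := by
  set z := zonalPoly n (fun i => (y : EuclideanSpace ℝ (Fin d)) i)
  have h1 := sphInt_infRot_infRot_mul z p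
  have h2 : sphInt d ((∑ i, ∑ j, infRot i j (infRot i j z)) * p) =
      -2 * eig d n * sphInt d (z * p) := by
    rw [sphInt_apply, restrictSph_mul, restrictSph_sum_infRot_zonalPoly hd, smul_mul_assoc,
      ← restrictSph_mul, ← map_smul, ← sphInt_apply, map_smul, smul_eq_mul]
  have h3 : sphInt d (z * ∑ i, ∑ j, infRot i j (infRot i j p)) =
      -2 * eig d k * sphInt d (z * p) := by
    rw [sum_infRot_infRot (mem_harmonicPoly.1 hp).1, (mem_harmonicPoly.1 hp).2]
    have e : z * (2 * (normSqPoly d * 0 - C (eig d k) * p)) = C (-2 * eig d k) * (z * p) := by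
      simp only [C_mul, C_neg, map_ofNat]
      ring
    rw [e, ← smul_eq_C_mul, map_smul, smul_eq_mul]
  rw [h2, h3] at h1
  by_contra hne
  have := mul_right_cancel₀ hne h1
  exact h (eig_injective hd (by linarith)).symm

/-- The functional `f ↦ ∫ f g dσ` on continuous functions. -/
def innerC {d : ℕ} (g : C(Sph d, ℝ)) : C(Sph d, ℝ) →L[ℝ] ℝ :=
  (innerSL ℝ (toL2 d g)).comp (toL2 d)

lemma innerC_apply {d : ℕ} (f g : C(Sph d, ℝ)) :
    innerC g f = ∫ x, g x * f x ∂sphMeasure d := by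
  rw [← inner_toL2]
  rfl

lemma innerC_restrictSph {d : ℕ} (p q : MvPolynomial (Fin d) ℝ) :
    innerC (restrictSph d q) (restrictSph d p) = sphInt d (q * p) :=
  inner_toL2_restrictSph q p

/-- Zonal polynomials restrict to spherical harmonics. -/
lemma exists_harmonic_eq_zonalPoly {d : ℕ} (hd : 2 ≤ d) (n : ℕ) (y : Sph d) :
    ∃ h ∈ harmonicPoly d n, restrictSph d h =
      restrictSph d (zonalPoly n fun i => (y : EuclideanSpace ℝ (Fin d)) i) := by
  set z := zonalPoly n (fun i => (y : EuclideanSpace ℝ (Fin d)) i) with hz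
  have hmem := restrictSph_mem_iSup_of_totalDegree_le hd
    (totalDegree_zonalPoly_le n (fun i => (y : EuclideanSpace ℝ (Fin d)) i))
  rw [← hz, ← Set.Iio_insert, iSup_insert, Submodule.mem_sup] at hmem
  obtain ⟨_, ⟨h, hh, rfl⟩, g, hg, hsum⟩ := hmem
  refine ⟨h, hh, ?_⟩
  have hgz : g = restrictSph d (z - h) := by
    rw [map_sub, ← hsum, add_sub_cancel_left]
  -- The remainder `g` is a sum of harmonics of degree below `n`, yet it is orthogonal to all of
  -- these, hence to itself.
  have hle : (⨆ j ∈ Set.Iio n, (harmonicPoly d j).map (restrictSph d)) ≤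
      LinearMap.ker (innerC g).toLinearMap := by
    refine iSup₂_le fun j hj => ?_
    rintro _ ⟨p, hp, rfl⟩
    rw [LinearMap.mem_ker, hgz]
    have hjn : j ≠ n := (Set.mem_Iio.1 hj).ne
    refine (innerC_restrictSph p (z - h)).trans ?_
    rw [sub_mul, map_sub, sphInt_zonalPoly_mul_of_ne hd y hp hjn,
      sphInt_mul_harmonic_eq_zero hd hh hp hjn.symm, sub_zero]
  have h0 : g = 0 := continuousMap_eq_zero_of_integral_sq (by
    rw [← innerC_apply]
    exact hle hg)
  rw [← hsum, h0, add_zero]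

lemma integral_harmC_sq {d : ℕ} (Y : HarmBasis d) (n : ℕ) (j : Fin (dimHarm d n)) :
    ∫ x, harmC Y n j x * harmC Y n j x ∂sphMeasure d = 1 := by
  rw [← fourierCoeff_toL2, fourierCoeff_harmC_self, if_pos rfl]

/-- The addition theorem for spherical harmonics. -/
lemma sum_harmC_mul_harmC {d : ℕ} (hd : 2 ≤ d) (Y : HarmBasis d) (n : ℕ) (x y : Sph d) :
    ∑ j, harmC Y n j x * harmC Y n j y = (dimHarm d n : ℝ) *
      gegenbauerW (((d : ℝ) - 2) / 2) n
        (inner ℝ (x : EuclideanSpace ℝ (Fin d)) (y : EuclideanSpace ℝ (Fin d))) := by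
  set c := (gegPoly d n).coeff n * linFormConst d n with hc
  have hW (x y : Sph d) : gegenbauerW (((d : ℝ) - 2) / 2) n
      (inner ℝ (x : EuclideanSpace ℝ (Fin d)) (y : EuclideanSpace ℝ (Fin d))) =
      c * ∑ j, harmC Y n j x * harmC Y n j y := by
    obtain ⟨h, hh, hz⟩ := exists_harmonic_eq_zonalPoly hd n y
    have h1 := restrictSph_eq_sum_harmC Y hh
    have h2 (j : Fin (dimHarm d n)) : sphInt d (harmRep Y n j * h) = c * harmC Y n j y := by
      rw [← inner_toL2_restrictSph, hz, inner_toL2_restrictSph,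
        sphInt_mul_zonalPoly hd (harmRep_mem Y n j), harmC, restrictSph_apply]
    rw [← restrictSph_zonalPoly, ← hz, h1]
    simp only [h2, ContinuousMap.sum_apply, ContinuousMap.smul_apply, smul_eq_mul, Finset.mul_sum]
    exact Finset.sum_congr rfl fun j _ => by ring
  have hdiag (y : Sph d) : c * ∑ j, harmC Y n j y * harmC Y n j y = 1 := by
    have h1 : inner ℝ (y : EuclideanSpace ℝ (Fin d)) (y : EuclideanSpace ℝ (Fin d)) = (1 : ℝ) := by
      rw [real_inner_self_eq_norm_sq]
      simp
    rw [← hW, h1, gegenbauerW_one]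
  -- Integrate the diagonal identity: the measure has mass one and each of the `N` basis functions
  -- has norm one.
  have hN : c * dimHarm d n = 1 := by
    have := sphMeasure_isProbability (d := d) (by omega)
    have h : ∫ y, c * ∑ j, harmC Y n j y * harmC Y n j y ∂sphMeasure d = 1 := by
      simp [hdiag]
    rw [integral_const_mul, integral_finsetSum] at h
    · simpa [integral_harmC_sq] using h
    · intro j _
      exact Continuous.integrable_of_hasCompactSupport (by fun_prop)
        (HasCompactSupport.of_compactSpace _)
  rw [hW, ← mul_assoc, mul_comm (dimHarm d n : ℝ), hN, one_mul]

lemma sum_harmC_sq {d : ℕ} (hd : 2 ≤ d) (Y : HarmBasis d) (n : ℕ) (x : Sph d) :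
    ∑ j, harmC Y n j x ^ 2 = dimHarm d n := by
  have h1 : inner ℝ (x : EuclideanSpace ℝ (Fin d)) (x : EuclideanSpace ℝ (Fin d)) = (1 : ℝ) := by
    rw [real_inner_self_eq_norm_sq]
    simp
  simp only [pow_two]
  rw [sum_harmC_mul_harmC hd, h1, gegenbauerW_one, mul_one]

end

/-! ### Growth of the dimension and convergence of the weights -/

section

open MvPolynomial

/-- The exponent of degree `n` with first entry `a` and middle entries `b`. -/
def lowExponent {e : ℕ} (n : ℕ) (a : Fin 2) (b : Fin e → Fin (n + 1)) : Fin (e + 2) →₀ ℕ :=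
  Finsupp.equivFunOnFinite.symm
    (Fin.cons (a : ℕ) (Fin.snoc (fun i => (b i : ℕ)) (n - a - ∑ i, (b i : ℕ)) : Fin (e + 1) → ℕ))

lemma exists_lowExponent {e n : ℕ} (s : Fin (e + 2) →₀ ℕ) (h0 : s 0 < 2) (hs : s.degree = n) :
    ∃ a b, s = lowExponent n a b := by
  have hsum : n = s 0 + (∑ i : Fin e, s i.castSucc.succ + s (Fin.last e).succ) := by
    rw [← hs, Finsupp.degree_eq_sum, Fin.sum_univ_succ, Fin.sum_univ_castSucc]
  have hle (i : Fin e) : s i.castSucc.succ ≤ ∑ i : Fin e, s i.castSucc.succ :=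
    Finset.single_le_sum (f := fun i : Fin e => s i.castSucc.succ) (fun _ _ => Nat.zero_le _)
      (Finset.mem_univ i)
  refine ⟨⟨s 0, h0⟩, fun i => ⟨s i.castSucc.succ, by have := hle i; omega⟩, ?_⟩
  ext i
  refine Fin.cases ?_ (fun i => ?_) i
  · simp [lowExponent]
  · refine Fin.lastCases ?_ (fun i => ?_) i
    · simp only [lowExponent, Finsupp.equivFunOnFinite_symm_apply_apply, Fin.cons_succ,
        Fin.snoc_last]
      omega
    · simp [lowExponent]

/-- A harmonic homogeneous polynomial is determined by its coefficients of order at most `1` in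
the first variable. -/
lemma harmonicPoly_eq_zero_of_coeff {e n : ℕ} {p : MvPolynomial (Fin (e + 2)) ℝ}
    (hp : p ∈ harmonicPoly (e + 2) n) (h : ∀ a b, coeff (lowExponent n a b) p = 0) : p = 0 := by
  obtain ⟨hom, hlap⟩ := mem_harmonicPoly.1 hp
  have key : ∀ k : ℕ, ∀ s : Fin (e + 2) →₀ ℕ, s 0 = k → coeff s p = 0 := by
    intro k
    induction k using Nat.strong_induction_on with
    | _ k ih =>
      intro s hs
      by_cases hdeg : s.degree = n
      swap
      · exact hom.coeff_eq_zero hdeg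
      rcases Nat.lt_or_ge k 2 with hk | hk
      · obtain ⟨a, b, rfl⟩ := exists_lowExponent s (by omega) hdeg
        exact h a b
      · obtain ⟨g, rfl⟩ : ∃ g, s = g + Finsupp.single 0 1 + Finsupp.single 0 1 := by
          refine ⟨s - Finsupp.single 0 2, ?_⟩
          rw [add_assoc, ← Finsupp.single_add, tsub_add_cancel_of_le]
          simpa [hs] using hk
        -- In this coefficient of `Δp = 0`, the terms with `i ≠ 0` involve exponents of the first
        -- variable smaller by two and vanish by induction; what remains is a nonzero multiple of
        -- the desired coefficient.
        have hc := congrArg (coeff g) hlap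
        rw [laplacian_apply, coeff_sum, Finset.sum_eq_single 0] at hc
        · simp only [coeff_pderiv, coeff_zero] at hc
          have h1 : ((g 0 : ℝ) + 1) ≠ 0 := by positivity
          have h2 : (((g + Finsupp.single 0 1 : Fin (e + 2) →₀ ℕ) 0 : ℕ) : ℝ) + 1 ≠ 0 := by
            positivity
          exact (mul_eq_zero.1 ((mul_eq_zero.1 hc).resolve_right h1)).resolve_right h2
        · intro i _ hi
          have hlt : (g + Finsupp.single i 1 + Finsupp.single i 1 : Fin (e + 2) →₀ ℕ) 0 < k := by
            rw [← hs]
            simp [Ne.symm hi]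
          rw [coeff_pderiv, coeff_pderiv, ih _ hlt _ rfl, zero_mul, zero_mul]
        · simp
  ext s
  rw [key _ s rfl, coeff_zero]

/-- Count the coefficients that determine a harmonic polynomial: two choices of the first exponent,
at most `n + 1` for each of the `d - 2` middle ones, and the last is fixed by the degree. -/
lemma dimHarm_le {d : ℕ} (hd : 2 ≤ d) (n : ℕ) : dimHarm d n ≤ 2 * (n + 1) ^ (d - 2) := by
  obtain ⟨e, rfl⟩ := Nat.exists_eq_add_of_le' hd
  let T : harmonicPoly (e + 2) n →ₗ[ℝ] (Fin 2 × (Fin e → Fin (n + 1)) → ℝ) :=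
    (LinearMap.pi fun s => lcoeff ℝ (lowExponent n s.1 s.2)) ∘ₗ (harmonicPoly (e + 2) n).subtype
  have hT : Function.Injective T := by
    rw [← LinearMap.ker_eq_bot, LinearMap.ker_eq_bot']
    intro p hp
    exact Subtype.ext (harmonicPoly_eq_zero_of_coeff p.2 fun a b => congrFun hp (a, b))
  have : FiniteDimensional ℝ (harmonicPoly (e + 2) n) := Module.Finite.of_injective T hT
  calc dimHarm (e + 2) n ≤ Module.finrank ℝ ((harmonicPoly (e + 2) n).map (restrictSph (e + 2))) :=
        Submodule.finrank_map_le _ _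
    _ ≤ Module.finrank ℝ (harmonicPoly (e + 2) n) := Submodule.finrank_map_le _ _
    _ ≤ Module.finrank ℝ (Fin 2 × (Fin e → Fin (n + 1)) → ℝ) :=
        LinearMap.finrank_le_finrank_of_injective hT
    _ = 2 * (n + 1) ^ (e + 2 - 2) := by simp

lemma natCast_sq_le_eig {d n : ℕ} (hd : 2 ≤ d) : (n : ℝ) ^ 2 ≤ eig d n := by
  have h1 : (2 : ℝ) ≤ d := by exact_mod_cast hd
  rw [pow_two, eig]
  exact mul_le_mul_of_nonneg_left (by linarith) n.cast_nonneg

/-- For `n ≥ 1` the weight is at least `n^(2m) ≥ n^d` and the dimension is `O(n^(d-2))`, so the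
terms are `O(n^(-2))`. -/
lemma summable_dimHarm_div_eig_pow {d m : ℕ} (hd : 2 ≤ d) (hm : d ≤ 2 * m) :
    Summable fun n : ℕ => (eig d (n + 1) ^ m)⁻¹ * (dimHarm d (n + 1) : ℝ) := by
  have hs : Summable fun n : ℕ => (2 : ℝ) * 2 ^ (d - 2) * (((n + 1 : ℕ) : ℝ) ^ 2)⁻¹ :=
    ((summable_nat_add_iff 1).2 (Real.summable_nat_pow_inv.2 one_lt_two)).mul_left _
  refine Summable.of_nonneg_of_le (fun n => ?_) (fun n => ?_) hs
  · have := eig_pos hd (Nat.succ_pos n)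
    positivity
  · have hx : (1 : ℝ) ≤ ((n + 1 : ℕ) : ℝ) := by exact_mod_cast Nat.succ_pos n
    set x : ℝ := ((n + 1 : ℕ) : ℝ) with hxdef
    have hx0 : 0 < x := by linarith
    have h1 : x ^ d ≤ eig d (n + 1) ^ m :=
      calc x ^ d ≤ x ^ (2 * m) := pow_le_pow_right₀ hx hm
        _ = (x ^ 2) ^ m := pow_mul _ _ _
        _ ≤ eig d (n + 1) ^ m := pow_le_pow_left₀ (by positivity) (natCast_sq_le_eig hd) m
    have h2 : (dimHarm d (n + 1) : ℝ) ≤ 2 * (2 * x) ^ (d - 2) :=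
      calc (dimHarm d (n + 1) : ℝ) ≤ 2 * (x + 1) ^ (d - 2) := by
            rw [hxdef]
            exact_mod_cast dimHarm_le hd (n + 1)
        _ ≤ 2 * (2 * x) ^ (d - 2) := by
            gcongr
            linarith
    calc (eig d (n + 1) ^ m)⁻¹ * (dimHarm d (n + 1) : ℝ)
        ≤ (x ^ d)⁻¹ * (2 * (2 * x) ^ (d - 2)) := by gcongr
      _ = 2 * 2 ^ (d - 2) * (x ^ 2)⁻¹ := by
          have hd2 : x ^ d = x ^ (d - 2) * x ^ 2 := by rw [← pow_add, Nat.sub_add_cancel hd]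
          rw [hd2, mul_pow]
          field_simp

end

/-! ### Completeness of the spherical harmonics -/

/-- A continuous functional that vanishes on all spherical harmonics is zero. -/
lemma eq_zero_of_harmC {d : ℕ} (hd : 2 ≤ d) (Y : HarmBasis d) (φ : C(Sph d, ℝ) →L[ℝ] ℝ)
    (h : ∀ n j, φ (harmC Y n j) = 0) : φ = 0 := by
  have h1 (p : MvPolynomial (Fin d) ℝ) : φ (restrictSph d p) = 0 := by
    have hle : (⨆ j ∈ Set.Iic p.totalDegree, (harmonicPoly d j).map (restrictSph d)) ≤
        LinearMap.ker φ.toLinearMap := by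
      refine iSup₂_le fun n _ => ?_
      rintro _ ⟨q, hq, rfl⟩
      rw [LinearMap.mem_ker, restrictSph_eq_sum_harmC Y hq, map_sum]
      refine Finset.sum_eq_zero fun j _ => ?_
      rw [map_smul]
      exact (congrArg _ (h n j)).trans (smul_zero _)
    exact hle (restrictSph_mem_iSup_of_totalDegree_le hd le_rfl)
  let A : MvPolynomial (Fin d) ℝ →ₐ[ℝ] C(Sph d, ℝ) := MvPolynomial.aeval (fun i : Fin d =>
    (⟨fun x => (x : EuclideanSpace ℝ (Fin d)) i, by fun_prop⟩ : C(Sph d, ℝ)))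
  -- Stone–Weierstrass: the coordinates separate points, so polynomials are dense in the continuous
  -- functions.
  have hsep : A.range.SeparatesPoints := by
    intro x y hxy
    have : ∃ i, (x : EuclideanSpace ℝ (Fin d)) i ≠ (y : EuclideanSpace ℝ (Fin d)) i := by
      by_contra! hc
      exact hxy (Subtype.ext (PiLp.ext hc))
    obtain ⟨i, hi⟩ := this
    refine ⟨_, ⟨A (MvPolynomial.X i), ⟨_, rfl⟩, rfl⟩, ?_⟩
    simpa [A] using hi
  have htop := ContinuousMap.subalgebra_topologicalClosure_eq_top_of_separatesPoints A.range hsep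
  have hdense : Dense (A.range : Set C(Sph d, ℝ)) := by
    rw [dense_iff_closure_eq, ← Subalgebra.topologicalClosure_coe, htop, Algebra.coe_top]
  ext f
  refine hdense.induction (P := fun f => φ f = 0) ?_ (isClosed_eq φ.continuous continuous_const) f
  rintro _ ⟨p, rfl⟩
  exact h1 p

/-- Spherical harmonics form a complete system in `L²`. -/
lemma eq_zero_of_fourierCoeff {d : ℕ} (hd : 2 ≤ d) (Y : HarmBasis d) {f : L2 d}
    (h : ∀ n j, fourierCoeff Y f n j = 0) : f = 0 := by
  have hφ := eq_zero_of_harmC hd Y ((innerSL ℝ f).comp (toL2 d)) fun n j => by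
    rw [ContinuousLinearMap.comp_apply, innerSL_apply_apply, real_inner_comm, toL2_harmC]
    exact h n j
  have hdense : DenseRange (toL2 d) := ContinuousMap.toLp_denseRange ℝ (sphMeasure d) ℝ (by simp)
  refine hdense.induction_on (p := fun g => inner ℝ f g = 0) f ?_ ?_ |> inner_self_eq_zero.1
  · exact isClosed_eq (by fun_prop) continuous_const
  · intro g
    exact DFunLike.congr_fun hφ g

/-! ### Uniform convergence of Fourier series of finite energy -/

section Synthesis

variable {d m ℓ : ℕ} {Y : HarmBasis d}

lemma summable_energyTerm_self {f : L2 d} (hf : f ∈ truncSobolev d m ℓ Y) :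
    Summable fun k => energyTerm m Y f f (ℓ + 1 + k) := by
  have h : Summable fun n : ℕ => energyTerm m Y f f (n + 1) := hf.1
  refine ((summable_nat_add_iff ℓ).2 h).congr fun k => ?_
  rw [show k + ℓ + 1 = ℓ + 1 + k by ring]

lemma summable_abs_energyTerm (hd : 2 ≤ d) {f g : L2 d} (hf : f ∈ truncSobolev d m ℓ Y)
    (hg : g ∈ truncSobolev d m ℓ Y) :
    Summable fun k => |energyTerm m Y f g (ℓ + 1 + k)| := by
  refine Summable.of_nonneg_of_le (fun _ => abs_nonneg _) (fun k => ?_)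
    (((summable_energyTerm_self hf).add (summable_energyTerm_self hg)))
  have hw : 0 ≤ eig d (ℓ + 1 + k) ^ m := pow_nonneg (eig_pos hd (by omega)).le _
  simp only [energyTerm]
  rw [abs_mul, abs_of_nonneg hw, ← mul_add, ← Finset.sum_add_distrib]
  refine mul_le_mul_of_nonneg_left ((Finset.abs_sum_le_sum_abs _ _).trans
    (Finset.sum_le_sum fun j _ => abs_le.2 ⟨?_, ?_⟩)) hw
  · nlinarith [sq_nonneg (fourierCoeff Y f (ℓ + 1 + k) j + fourierCoeff Y g (ℓ + 1 + k) j),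
      sq_nonneg (fourierCoeff Y f (ℓ + 1 + k) j), sq_nonneg (fourierCoeff Y g (ℓ + 1 + k) j)]
  · nlinarith [sq_nonneg (fourierCoeff Y f (ℓ + 1 + k) j - fourierCoeff Y g (ℓ + 1 + k) j),
      sq_nonneg (fourierCoeff Y f (ℓ + 1 + k) j), sq_nonneg (fourierCoeff Y g (ℓ + 1 + k) j)]

lemma summable_dimHarm_shift (hd : 2 ≤ d) (hm : d ≤ 2 * m) (ℓ : ℕ) :
    Summable fun k : ℕ => (eig d (ℓ + 1 + k) ^ m)⁻¹ * (dimHarm d (ℓ + 1 + k) : ℝ) := by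
  refine ((summable_nat_add_iff ℓ).2 (summable_dimHarm_div_eig_pow hd hm)).congr fun k => ?_
  rw [show k + ℓ + 1 = ℓ + 1 + k by ring]

variable (Y) in
/-- The spherical harmonic `∑_j b_j Y_j^n`. -/
def harmSum (n : ℕ) (b : Fin (dimHarm d n) → ℝ) : C(Sph d, ℝ) := ∑ j, b j • harmC Y n j

lemma harmSum_apply (n : ℕ) (b : Fin (dimHarm d n) → ℝ) (x : Sph d) :
    harmSum Y n b x = ∑ j, b j * harmC Y n j x := by
  simp [harmSum]

/-- Weighted Young inequality, with `∑_j Y_j(x)² = N` independent of `x`. For `w = [n(n+d-2)]^m` the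
first term is the energy and the second is summable over `n`, which is the embedding into continuous
functions. -/
lemma norm_harmSum_le (hd : 2 ≤ d) (n : ℕ) (b : Fin (dimHarm d n) → ℝ) {w : ℝ} (hw : 0 < w) :
    ‖harmSum Y n b‖ ≤ w * ∑ j, b j * b j + w⁻¹ * dimHarm d n := by
  have h0 : 0 ≤ w * ∑ j, b j * b j + w⁻¹ * dimHarm d n :=
    add_nonneg (mul_nonneg hw.le (Finset.sum_nonneg fun _ _ => mul_self_nonneg _))
      (mul_nonneg (inv_nonneg.2 hw.le) (Nat.cast_nonneg _))
  refine (ContinuousMap.norm_le _ h0).2 fun x => ?_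
  rw [harmSum_apply, ← sum_harmC_sq hd Y n x, Finset.mul_sum, Finset.mul_sum,
    ← Finset.sum_add_distrib]
  refine (norm_sum_le _ _).trans (Finset.sum_le_sum fun j _ => ?_)
  set c := b j
  set e := harmC Y n j x
  have e1 : w * (c * c) + w⁻¹ * e ^ 2 = w * (|c| ^ 2 + (w⁻¹ * |e|) ^ 2) := by
    rw [sq_abs, mul_pow, sq_abs]
    field_simp
  have e2 : ‖c * e‖ = w * (|c| * (w⁻¹ * |e|)) := by
    rw [Real.norm_eq_abs, abs_mul]
    field_simp
  rw [e1, e2]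
  refine mul_le_mul_of_nonneg_left ?_ hw.le
  nlinarith [sq_nonneg (|c| - w⁻¹ * |e|), sq_nonneg (|c|), sq_nonneg (w⁻¹ * |e|)]

lemma fourierCoeff_harmSum (n : ℕ) (b : Fin (dimHarm d n) → ℝ) (i : Fin (dimHarm d n)) :
    fourierCoeff Y (toL2 d (harmSum Y n b)) n i = b i := by
  have h (j : Fin (dimHarm d n)) := fourierCoeff_harmC_self Y n i j
  simp only [fourierCoeff] at h ⊢
  simp [harmSum, map_sum, inner_sum, real_inner_smul_right, h]

lemma fourierCoeff_harmSum_of_ne (hd : 2 ≤ d) {n k : ℕ} (hnk : n ≠ k)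
    (b : Fin (dimHarm d k) → ℝ) (i : Fin (dimHarm d n)) :
    fourierCoeff Y (toL2 d (harmSum Y k b)) n i = 0 := by
  have h (j : Fin (dimHarm d k)) := fourierCoeff_harmC_of_ne hd Y hnk i j
  simp only [fourierCoeff] at h ⊢
  simp [harmSum, map_sum, inner_sum, real_inner_smul_right, h]

variable (Y) in
/-- The function with prescribed Fourier coefficients `b` in the degrees above `ℓ`. -/
def synth (ℓ : ℕ) (b : (k : ℕ) → Fin (dimHarm d (ℓ + 1 + k)) → ℝ) : C(Sph d, ℝ) :=
  ∑' k, harmSum Y (ℓ + 1 + k) (b k)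

variable {b : (k : ℕ) → Fin (dimHarm d (ℓ + 1 + k)) → ℝ}

lemma summable_harmSum (hd : 2 ≤ d) (hm : d ≤ 2 * m)
    (hb : Summable fun k => eig d (ℓ + 1 + k) ^ m * ∑ j, b k j * b k j) :
    Summable fun k => harmSum Y (ℓ + 1 + k) (b k) :=
  Summable.of_norm_bounded (hb.add (summable_dimHarm_shift hd hm ℓ)) fun k =>
    norm_harmSum_le hd _ _ (pow_pos (eig_pos hd (by omega)) _)

lemma synth_apply (hd : 2 ≤ d) (hm : d ≤ 2 * m)
    (hb : Summable fun k => eig d (ℓ + 1 + k) ^ m * ∑ j, b k j * b k j) (x : Sph d) :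
    synth Y ℓ b x = ∑' k, ∑ j, b k j * harmC Y (ℓ + 1 + k) j x := by
  refine ((ContinuousMap.evalCLM ℝ x).map_tsum (summable_harmSum hd hm hb)).trans ?_
  exact tsum_congr fun k => harmSum_apply _ _ _

/-- The series converges in sup norm, where a Fourier coefficient is a continuous functional. -/
lemma fourierCoeff_synth_eq_tsum (hd : 2 ≤ d) (hm : d ≤ 2 * m)
    (hb : Summable fun k => eig d (ℓ + 1 + k) ^ m * ∑ j, b k j * b k j) (n : ℕ)
    (i : Fin (dimHarm d n)) :
    fourierCoeff Y (toL2 d (synth Y ℓ b)) n i =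
      ∑' k, fourierCoeff Y (toL2 d (harmSum Y (ℓ + 1 + k) (b k))) n i :=
  ((innerSL ℝ ((Y n i : sphHarm d n) : L2 d)).comp (toL2 d)).map_tsum (summable_harmSum hd hm hb)

lemma fourierCoeff_synth (hd : 2 ≤ d) (hm : d ≤ 2 * m)
    (hb : Summable fun k => eig d (ℓ + 1 + k) ^ m * ∑ j, b k j * b k j) (k : ℕ)
    (i : Fin (dimHarm d (ℓ + 1 + k))) :
    fourierCoeff Y (toL2 d (synth Y ℓ b)) (ℓ + 1 + k) i = b k i := by
  rw [fourierCoeff_synth_eq_tsum hd hm hb, tsum_eq_single k, fourierCoeff_harmSum]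
  intro k' hk'
  exact fourierCoeff_harmSum_of_ne hd (by omega) _ _

lemma fourierCoeff_synth_of_le (hd : 2 ≤ d) (hm : d ≤ 2 * m)
    (hb : Summable fun k => eig d (ℓ + 1 + k) ^ m * ∑ j, b k j * b k j) {n : ℕ} (hn : n ≤ ℓ)
    (i : Fin (dimHarm d n)) :
    fourierCoeff Y (toL2 d (synth Y ℓ b)) n i = 0 := by
  rw [fourierCoeff_synth_eq_tsum hd hm hb]
  have h (k : ℕ) : fourierCoeff Y (toL2 d (harmSum Y (ℓ + 1 + k) (b k))) n i = 0 :=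
    fourierCoeff_harmSum_of_ne hd (by omega) _ _
  simp [h]

lemma synth_mem (hd : 2 ≤ d) (hm : d ≤ 2 * m)
    (hb : Summable fun k => eig d (ℓ + 1 + k) ^ m * ∑ j, b k j * b k j) :
    synth Y ℓ b ∈ truncSobolevC d m ℓ Y := by
  refine ⟨?_, fun n hn j => fourierCoeff_synth_of_le hd hm hb hn j⟩
  change Summable fun n : ℕ => energyTerm m Y (toL2 d (synth Y ℓ b)) (toL2 d (synth Y ℓ b)) (n + 1)
  rw [← summable_nat_add_iff ℓ]
  refine hb.congr fun k => ?_
  rw [show k + ℓ + 1 = ℓ + 1 + k by ring]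
  simp only [energyTerm, fourierCoeff_synth hd hm hb]

/-- Elements of the space are the sums of their Fourier series. -/
lemma toL2_synth_fourierCoeff (hd : 2 ≤ d) (hm : d ≤ 2 * m) {f : L2 d}
    (hf : f ∈ truncSobolev d m ℓ Y) :
    toL2 d (synth Y ℓ fun k j => fourierCoeff Y f (ℓ + 1 + k) j) = f := by
  have hb := summable_energyTerm_self hf
  rw [← sub_eq_zero]
  refine eq_zero_of_fourierCoeff hd Y fun n j => ?_
  have hsub (g h : L2 d) : fourierCoeff Y (g - h) n j =
      fourierCoeff Y g n j - fourierCoeff Y h n j :=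
    inner_sub_right _ _ _
  rw [hsub]
  rcases Nat.lt_or_ge ℓ n with hn | hn
  · obtain ⟨k, rfl⟩ := Nat.exists_eq_add_of_le (Nat.succ_le_of_lt hn)
    exact sub_eq_zero.2 (fourierCoeff_synth hd hm hb k j)
  · rw [fourierCoeff_synth_of_le hd hm hb hn, hf.2 n hn j, sub_zero]

lemma eq_synth_of_mem (hd : 2 ≤ d) (hm : d ≤ 2 * m) {f : C(Sph d, ℝ)}
    (hf : f ∈ truncSobolevC d m ℓ Y) :
    f = synth Y ℓ fun k j => fourierCoeff Y (toL2 d f) (ℓ + 1 + k) j :=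
  toL2_injective d (toL2_synth_fourierCoeff hd hm hf).symm

end Synthesis

/-! ### The Hilbert space structure -/

/-- A bijective linear map onto a Hilbert space transports the inner product. -/
lemma isHilbert_of_bijective {E F : Type*} [AddCommGroup E] [Module ℝ E] [NormedAddCommGroup F]
    [InnerProductSpace ℝ F] [CompleteSpace F] (T : E →ₗ[ℝ] F) (hT : Function.Bijective T) :
    IsHilbert fun f g => inner ℝ (T f) (T g) where
  symm f g := real_inner_comm _ _
  add_left f g h := by rw [map_add, inner_add_left]
  smul_left c f g := by rw [map_smul, real_inner_smul_left]
  pos f hf := real_inner_self_pos.2 ((map_ne_zero_iff T hT.1).2 hf)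
  complete u hu := by
    have hnorm (x : F) : √(inner ℝ x x) = ‖x‖ := by
      rw [real_inner_self_eq_norm_sq, Real.sqrt_sq (norm_nonneg _)]
    simp only [map_sub, hnorm] at hu ⊢
    have hc : CauchySeq fun p => T (u p) := by
      refine Metric.cauchySeq_iff.2 fun ε hε => ?_
      simpa only [dist_eq_norm] using hu ε hε
    obtain ⟨v, hv⟩ := cauchySeq_tendsto_of_complete hc
    obtain ⟨f, rfl⟩ := hT.2 v
    exact ⟨f, tendsto_iff_norm_sub_tendsto_zero.1 hv⟩

section Hilbert

variable {d m ℓ : ℕ} {Y : HarmBasis d}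

/-- The weighted Fourier coefficients of a function. -/
def weightedCoeff (m ℓ : ℕ) (Y : HarmBasis d) (f : L2 d) (k : ℕ) :
    EuclideanSpace ℝ (Fin (dimHarm d (ℓ + 1 + k))) :=
  WithLp.toLp 2 fun j => √(eig d (ℓ + 1 + k) ^ m) * fourierCoeff Y f (ℓ + 1 + k) j

lemma inner_weightedCoeff (hd : 2 ≤ d) (f g : L2 d) (k : ℕ) :
    inner ℝ (weightedCoeff m ℓ Y f k) (weightedCoeff m ℓ Y g k) =
      energyTerm m Y f g (ℓ + 1 + k) := by
  have hw : 0 ≤ eig d (ℓ + 1 + k) ^ m := pow_nonneg (eig_pos hd (by omega)).le _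
  rw [PiLp.inner_apply, energyTerm, Finset.mul_sum]
  refine Finset.sum_congr rfl fun j _ => ?_
  simp only [weightedCoeff, RCLike.inner_apply, conj_trivial]
  rw [mul_mul_mul_comm, Real.mul_self_sqrt hw, mul_comm (fourierCoeff Y g _ _)]

lemma norm_sq_weightedCoeff (hd : 2 ≤ d) (f : L2 d) (k : ℕ) :
    ‖weightedCoeff m ℓ Y f k‖ ^ 2 = energyTerm m Y f f (ℓ + 1 + k) := by
  rw [← inner_weightedCoeff hd, real_inner_self_eq_norm_sq]

/-- The isometry from the space of functions to the `ℓ²` space of weighted coefficients. -/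
def coeffMap (hd : 2 ≤ d) (m ℓ : ℕ) (Y : HarmBasis d) : truncSobolevC d m ℓ Y →ₗ[ℝ]
    lp (fun k : ℕ => EuclideanSpace ℝ (Fin (dimHarm d (ℓ + 1 + k)))) 2 where
  toFun f := ⟨weightedCoeff m ℓ Y (toL2 d f), memℓp_gen (by
    refine (summable_energyTerm_self f.2).congr fun k => ?_
    rw [ENNReal.toReal_ofNat, Real.rpow_ofNat]
    exact (norm_sq_weightedCoeff hd _ k).symm)⟩
  map_add' f g := by
    ext k j
    change √_ * fourierCoeff Y (toL2 d (f + g : C(Sph d, ℝ))) _ j = √_ * _ + √_ * _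
    rw [map_add, fourierCoeff_add, mul_add]
  map_smul' c f := by
    ext k j
    simp [weightedCoeff, fourierCoeff_smul, mul_left_comm]

lemma inner_coeffMap (hd : 2 ≤ d) (f g : truncSobolevC d m ℓ Y) :
    inner ℝ (coeffMap hd m ℓ Y f) (coeffMap hd m ℓ Y g) =
      energy m ℓ Y (toL2 d (f : C(Sph d, ℝ))) (toL2 d (g : C(Sph d, ℝ))) := by
  rw [lp.inner_eq_tsum, energy]
  exact tsum_congr fun k => inner_weightedCoeff hd _ _ k

/-- Injectivity is completeness of the harmonics. For surjectivity, dividing an `ℓ²` sequence by the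
square roots of the weights gives coefficients of finite energy, whose series is a continuous
function in the space. -/
lemma coeffMap_bijective (hd : 2 ≤ d) (hm : d ≤ 2 * m) :
    Function.Bijective (coeffMap hd m ℓ Y) := by
  have hw (k : ℕ) : 0 < eig d (ℓ + 1 + k) ^ m := pow_pos (eig_pos hd (by omega)) _
  constructor
  · rw [← LinearMap.ker_eq_bot, LinearMap.ker_eq_bot']
    intro f hf
    refine Subtype.ext (toL2_injective d ?_)
    refine (eq_zero_of_fourierCoeff hd Y fun n j => ?_).trans (map_zero (toL2 d)).symm
    rcases Nat.lt_or_ge ℓ n with hn | hn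
    · obtain ⟨k, rfl⟩ := Nat.exists_eq_add_of_le (Nat.succ_le_of_lt hn)
      have h : √(eig d (ℓ + 1 + k) ^ m) * fourierCoeff Y (toL2 d (f : C(Sph d, ℝ))) (ℓ + 1 + k) j
          = 0 := congrArg (fun v => v k j) (congrArg Subtype.val hf)
      exact (mul_eq_zero.1 h).resolve_left (Real.sqrt_pos.2 (hw k)).ne'
    · exact f.2.2 n hn j
  · intro v
    let b : (k : ℕ) → Fin (dimHarm d (ℓ + 1 + k)) → ℝ :=
      fun k j => (√(eig d (ℓ + 1 + k) ^ m))⁻¹ * v k j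
    have hb : Summable fun k => eig d (ℓ + 1 + k) ^ m * ∑ j, b k j * b k j := by
      refine ((lp.memℓp v).summable (by simp)).congr fun k => ?_
      rw [ENNReal.toReal_ofNat, Real.rpow_ofNat, EuclideanSpace.norm_sq_eq, Finset.mul_sum]
      refine Finset.sum_congr rfl fun j _ => ?_
      rw [Real.norm_eq_abs, sq_abs, mul_mul_mul_comm, ← mul_inv, Real.mul_self_sqrt (hw k).le,
        mul_inv_cancel_left₀ (hw k).ne', pow_two]
    refine ⟨⟨synth Y ℓ b, synth_mem hd hm hb⟩, ?_⟩
    ext k j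
    change √(eig d (ℓ + 1 + k) ^ m) * fourierCoeff Y (toL2 d (synth Y ℓ b)) (ℓ + 1 + k) j = v k j
    rw [fourierCoeff_synth hd hm hb]
    exact mul_inv_cancel_left₀ (Real.sqrt_pos.2 (hw k)).ne' _

lemma isHilbert_energy (hd : 2 ≤ d) (hm : d ≤ 2 * m) :
    IsHilbert fun f g : truncSobolevC d m ℓ Y =>
      energy m ℓ Y (toL2 d (f : C(Sph d, ℝ))) (toL2 d (g : C(Sph d, ℝ))) := by
  have h := isHilbert_of_bijective (coeffMap hd m ℓ Y) (coeffMap_bijective hd hm)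
  simpa only [inner_coeffMap] using h

/-! ### The reproducing kernel -/

lemma kernelTerm_eq (Y : HarmBasis d) (hd : 2 ≤ d) (m : ℕ) (x y : Sph d) (n : ℕ) :
    kernelTerm d m x y n = (eig d n ^ m)⁻¹ * ∑ j, harmC Y n j x * harmC Y n j y := by
  rw [kernelTerm, sum_harmC_mul_harmC hd, mul_assoc]

lemma abs_kernelTerm_le (Y : HarmBasis d) (hd : 2 ≤ d) (m : ℕ) (x y : Sph d) {n : ℕ} (hn : 0 < n) :
    |kernelTerm d m x y n| ≤ (eig d n ^ m)⁻¹ * dimHarm d n := by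
  have hw : 0 ≤ (eig d n ^ m)⁻¹ := inv_nonneg.2 (pow_nonneg (eig_pos hd hn).le _)
  rw [kernelTerm_eq Y hd, abs_mul, abs_of_nonneg hw]
  refine mul_le_mul_of_nonneg_left ?_ hw
  have hx := sum_harmC_sq hd Y n x
  have hy := sum_harmC_sq hd Y n y
  have h : |∑ j, harmC Y n j x * harmC Y n j y| ≤
      ∑ j, (harmC Y n j x ^ 2 + harmC Y n j y ^ 2) / 2 := by
    refine (Finset.abs_sum_le_sum_abs _ _).trans (Finset.sum_le_sum fun j _ => abs_le.2 ⟨?_, ?_⟩)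
    · nlinarith [sq_nonneg (harmC Y n j x + harmC Y n j y)]
    · nlinarith [sq_nonneg (harmC Y n j x - harmC Y n j y)]
  rw [← Finset.sum_div, Finset.sum_add_distrib, hx, hy] at h
  linarith

lemma summable_abs_kernelTerm (Y : HarmBasis d) (hd : 2 ≤ d) (hm : d ≤ 2 * m) (ℓ : ℕ) (x y : Sph d) :
    Summable fun k => |kernelTerm d m x y (ℓ + 1 + k)| :=
  Summable.of_nonneg_of_le (fun _ => abs_nonneg _)
    (fun _ => abs_kernelTerm_le Y hd m x y (by omega)) (summable_dimHarm_shift hd hm ℓ)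

lemma continuous_kernel (Y : HarmBasis d) (hd : 2 ≤ d) (hm : d ≤ 2 * m) (ℓ : ℕ) :
    Continuous (Function.uncurry (kernel d m ℓ)) := by
  refine continuous_tsum (f := fun k (z : Sph d × Sph d) => kernelTerm d m z.1 z.2 (ℓ + 1 + k))
    (fun k => ?_) (summable_dimHarm_shift hd hm ℓ)
    (fun k z => abs_kernelTerm_le Y hd m z.1 z.2 (by omega))
  simp only [kernelTerm_eq Y hd]
  fun_prop

lemma isReproducingKernel_kernel (hd : 2 ≤ d) (hm : d ≤ 2 * m) :
    IsReproducingKernel (truncSobolevC d m ℓ Y)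
      (fun f g => energy m ℓ Y (toL2 d (f : C(Sph d, ℝ))) (toL2 d (g : C(Sph d, ℝ))))
      (kernel d m ℓ) := by
  refine ⟨isHilbert_energy hd hm, fun y => ?_⟩
  have hw (k : ℕ) : 0 < eig d (ℓ + 1 + k) ^ m := pow_pos (eig_pos hd (by omega)) _
  -- These are the Fourier coefficients of `K(·, y)` by the addition theorem; the inverse weight
  -- cancels the weight in the energy.
  let b : (k : ℕ) → Fin (dimHarm d (ℓ + 1 + k)) → ℝ :=
    fun k j => (eig d (ℓ + 1 + k) ^ m)⁻¹ * harmC Y (ℓ + 1 + k) j y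
  have hb : Summable fun k => eig d (ℓ + 1 + k) ^ m * ∑ j, b k j * b k j := by
    refine (summable_dimHarm_shift hd hm ℓ).congr fun k => ?_
    rw [← sum_harmC_sq hd Y _ y, Finset.mul_sum, Finset.mul_sum]
    refine Finset.sum_congr rfl fun j _ => ?_
    have := (hw k).ne'
    simp only [b]
    field_simp
  refine ⟨⟨synth Y ℓ b, synth_mem hd hm hb⟩, fun x => ?_, fun f => ?_⟩
  · change synth Y ℓ b x = _
    rw [synth_apply hd hm hb, kernel]
    refine tsum_congr fun k => ?_
    rw [kernelTerm_eq Y hd, Finset.mul_sum]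
    exact Finset.sum_congr rfl fun j _ => by simp only [b]; ring
  · change energy m ℓ Y (toL2 d (f : C(Sph d, ℝ))) (toL2 d (synth Y ℓ b)) = _
    have hf : (f : C(Sph d, ℝ)) y = ∑' k, ∑ j,
        fourierCoeff Y (toL2 d (f : C(Sph d, ℝ))) (ℓ + 1 + k) j * harmC Y (ℓ + 1 + k) j y :=
      (DFunLike.congr_fun (eq_synth_of_mem hd hm f.2) y).trans
        (synth_apply hd hm (summable_energyTerm_self f.2) y)
    rw [hf, energy]
    refine tsum_congr fun k => ?_
    rw [energyTerm, Finset.mul_sum]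
    refine Finset.sum_congr rfl fun j _ => ?_
    rw [fourierCoeff_synth hd hm hb]
    have := (hw k).ne'
    simp only [b]
    field_simp

/-! ### Strict positive definiteness -/

/-- A nontrivial combination of point evaluations does not annihilate the spherical harmonics of
all large degrees. -/
lemma eq_zero_of_sum_harmC_eq_zero (hd : 2 ≤ d) (Y : HarmBasis d) (ℓ : ℕ) {n : ℕ}
    (x : Fin n → Sph d) (a : Fin n → ℝ) (hx : Function.Injective x)
    (h : ∀ k j, ∑ i, a i * harmC Y (ℓ + 1 + k) j (x i) = 0) : a = 0 := by
  let φ : C(Sph d, ℝ) →L[ℝ] ℝ := ∑ i, a i • ContinuousMap.evalCLM ℝ (x i)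
  have hφ (f : C(Sph d, ℝ)) : φ f = ∑ i, a i * f (x i) := by
    simp [φ]
  -- The harmonic part of `φ` in degrees at most `ℓ`: integration against `q` agrees with `φ` there,
  -- and in higher degrees both vanish.
  let q : C(Sph d, ℝ) := ∑ k ∈ Finset.range (ℓ + 1), ∑ j, φ (harmC Y k j) • harmC Y k j
  have hinner (k : ℕ) (j : Fin (dimHarm d k)) (f : C(Sph d, ℝ)) :
      inner ℝ (toL2 d (harmC Y k j)) (toL2 d f) = fourierCoeff Y (toL2 d f) k j := by
    rw [fourierCoeff, toL2_harmC]
  have hq (f : C(Sph d, ℝ)) : innerC q f =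
      ∑ k ∈ Finset.range (ℓ + 1), ∑ j, φ (harmC Y k j) * fourierCoeff Y (toL2 d f) k j := by
    change inner ℝ (toL2 d q) (toL2 d f) = _
    simp only [q, map_sum, map_smul, sum_inner, real_inner_smul_left, hinner]
  have hzero : φ - innerC q = 0 := by
    refine eq_zero_of_harmC hd Y _ fun k j => ?_
    rw [sub_apply, hq, sub_eq_zero]
    rcases Nat.lt_or_ge k (ℓ + 1) with hk | hk
    · rw [Finset.sum_eq_single_of_mem k (Finset.mem_range.2 hk)]
      · simp [fourierCoeff_harmC_self]
      · intro k' _ hne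
        simp [fourierCoeff_harmC_of_ne hd Y hne]
    · rw [Finset.sum_eq_zero]
      · obtain ⟨k, rfl⟩ := Nat.exists_eq_add_of_le hk
        rw [hφ, h]
      · intro k' hk'
        have := Finset.mem_range.1 hk'
        simp [fourierCoeff_harmC_of_ne hd Y (show k' ≠ k by omega)]
  have hint (f : C(Sph d, ℝ)) : ∑ i, a i * f (x i) = ∫ z, q z * f z ∂sphMeasure d := by
    rw [← hφ, ← innerC_apply, ← sub_eq_zero]
    exact DFunLike.congr_fun hzero f
  ext i₀
  -- A peak function: `g` is one at `x i₀` and less than one elsewhere. Along `g ^ N` the point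
  -- evaluations tend to `a i₀`, while the integrals tend to zero because `x i₀` is a null set.
  let g : C(Sph d, ℝ) := ⟨fun z => max 0 (1 - dist z (x i₀)), by fun_prop⟩
  have hg0 (z : Sph d) : 0 ≤ g z := le_max_left _ _
  have hg1 (z : Sph d) : g z ≤ 1 := max_le zero_le_one (by linarith [dist_nonneg (x := z) (y := x i₀)])
  have hgx : g (x i₀) = 1 := by simp [g]
  have hglt {z : Sph d} (hz : z ≠ x i₀) : g z < 1 :=
    max_lt zero_lt_one (by linarith [dist_pos.2 hz])
  have hpow {z : Sph d} (hz : z ≠ x i₀) : Tendsto (fun N : ℕ => g z ^ N) atTop (𝓝 0) :=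
    tendsto_pow_atTop_nhds_zero_of_lt_one (hg0 z) (hglt hz)
  have hlim1 : Tendsto (fun N : ℕ => ∑ i, a i * (g ^ N) (x i)) atTop (𝓝 (a i₀)) := by
    have hval : ∑ i, a i * (if i = i₀ then 1 else 0) = a i₀ := by simp
    rw [← hval]
    refine tendsto_finsetSum _ fun i _ => Tendsto.const_mul _ ?_
    split_ifs with hi
    · simp [hi, hgx]
    · simpa using hpow (hx.ne hi)
  have hlim2 : Tendsto (fun N : ℕ => ∫ z, q z * (g ^ N) z ∂sphMeasure d) atTop (𝓝 0) := by
    have hz : ∫ _, (0 : ℝ) ∂sphMeasure d = 0 := integral_zero _ _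
    rw [← hz]
    refine tendsto_integral_of_dominated_convergence (fun _ => ‖q‖)
      (fun N => Continuous.aestronglyMeasurable (by fun_prop)) (integrable_const _)
      (fun N => Eventually.of_forall fun z => ?_) ?_
    · rw [norm_mul, ContinuousMap.pow_apply, norm_pow, Real.norm_of_nonneg (hg0 z)]
      exact mul_le_of_le_one_right (norm_nonneg _) (pow_le_one₀ (hg0 z) (hg1 z)) |>.trans
        (q.norm_coe_le_norm z)
    · have hae : ∀ᵐ z ∂sphMeasure d, z ≠ x i₀ :=
        measure_eq_zero_iff_ae_notMem.1 (sphMeasure_singleton hd (x i₀))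
      filter_upwards [hae] with z hz
      simpa using (hpow hz).const_mul (q z)
  simp only [hint] at hlim1
  exact tendsto_nhds_unique hlim1 hlim2

/-- By the addition theorem the kernel term of each degree is a weighted sum of products `Y_j(x)
Y_j(y)`, so its quadratic form is a sum of squares. -/
lemma hasSum_sum_mul_kernel (hd : 2 ≤ d) (hm : d ≤ 2 * m) (Y : HarmBasis d) (ℓ : ℕ) {n : ℕ}
    (x : Fin n → Sph d) (a : Fin n → ℝ) :
    HasSum (fun k => (eig d (ℓ + 1 + k) ^ m)⁻¹ *
        ∑ j, (∑ i, a i * harmC Y (ℓ + 1 + k) j (x i)) ^ 2)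
      (∑ i, ∑ j, a i * a j * kernel d m ℓ (x i) (x j)) := by
  have h : HasSum (fun k => ∑ i, ∑ j, a i * a j * kernelTerm d m (x i) (x j) (ℓ + 1 + k))
      (∑ i, ∑ j, a i * a j * kernel d m ℓ (x i) (x j)) :=
    hasSum_sum fun i _ => hasSum_sum fun j _ =>
      (summable_abs_kernelTerm Y hd hm ℓ (x i) (x j)).of_abs.hasSum.mul_left _
  convert h using 1
  funext k
  simp only [kernelTerm_eq Y hd, pow_two, Finset.sum_mul_sum]
  simp only [Finset.mul_sum]
  rw [Finset.sum_comm]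
  refine Finset.sum_congr rfl fun i _ => ?_
  rw [Finset.sum_comm]
  exact Finset.sum_congr rfl fun i' _ => Finset.sum_congr rfl fun j _ => by ring

lemma isStrictlyPosDef_kernel (Y : HarmBasis d) (hd : 2 ≤ d) (hm : d ≤ 2 * m) (ℓ : ℕ) :
    IsStrictlyPosDef (kernel d m ℓ) := by
  refine ⟨fun x y => ?_, fun n x a hx ha => ?_⟩
  · simp only [kernel, kernelTerm_eq Y hd, mul_comm]
  · have hw (k : ℕ) : 0 < (eig d (ℓ + 1 + k) ^ m)⁻¹ :=
      inv_pos.2 (pow_pos (eig_pos hd (by omega)) _)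
    have hs := hasSum_sum_mul_kernel hd hm Y ℓ x a
    have hsq (k : ℕ) : 0 ≤ ∑ j, (∑ i, a i * harmC Y (ℓ + 1 + k) j (x i)) ^ 2 :=
      Finset.sum_nonneg fun _ _ => sq_nonneg _
    have hnn (k : ℕ) : 0 ≤ (eig d (ℓ + 1 + k) ^ m)⁻¹ *
        ∑ j, (∑ i, a i * harmC Y (ℓ + 1 + k) j (x i)) ^ 2 := mul_nonneg (hw k).le (hsq k)
    refine lt_of_le_of_ne (hs.nonneg hnn) fun h0 => ha ?_
    rw [← h0, hasSum_zero_iff_of_nonneg hnn] at hs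
    refine eq_zero_of_sum_harmC_eq_zero hd Y ℓ x a hx fun k j => ?_
    have hk := (mul_eq_zero.1 (congrFun hs k)).resolve_left (hw k).ne'
    exact pow_eq_zero_iff two_ne_zero |>.1
      ((Finset.sum_eq_zero_iff_of_nonneg fun _ _ => sq_nonneg _).1 hk j (Finset.mem_univ j))

end Hilbert

end SphereSpline

end

theorem lemma3p1 (d m ℓ : ℕ) (hd : 2 ≤ d) (hm : d ≤ 2 * m)
    (Y : SphereSpline.HarmBasis d) :
    -- the series that define the kernel and the inner product converge absolutely
    (∀ x y : SphereSpline.Sph d,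
      Summable fun k : ℕ => |SphereSpline.kernelTerm d m x y (ℓ + 1 + k)|) ∧
    (∀ f ∈ SphereSpline.truncSobolev d m ℓ Y, ∀ g ∈ SphereSpline.truncSobolev d m ℓ Y,
      Summable fun k : ℕ => |SphereSpline.energyTerm m Y f g (ℓ + 1 + k)|) ∧
    -- every class in the space has exactly one continuous representative
    (∀ f ∈ SphereSpline.truncSobolev d m ℓ Y,
      ∃! g : C(SphereSpline.Sph d, ℝ), SphereSpline.toL2 d g = f) ∧
    -- the space is a Hilbert space with the given reproducing kernel
    SphereSpline.IsReproducingKernel (SphereSpline.truncSobolevC d m ℓ Y)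
      (fun f g => SphereSpline.energy m ℓ Y
        (SphereSpline.toL2 d (f : C(SphereSpline.Sph d, ℝ)))
        (SphereSpline.toL2 d (g : C(SphereSpline.Sph d, ℝ))))
      (SphereSpline.kernel d m ℓ) ∧
    -- the kernel is continuous and strictly positive definite
    Continuous (Function.uncurry (SphereSpline.kernel d m ℓ)) ∧
    SphereSpline.IsStrictlyPosDef (SphereSpline.kernel d m ℓ) := by
  exact ⟨fun x y => SphereSpline.summable_abs_kernelTerm Y hd hm ℓ x y,
    fun f hf g hg => SphereSpline.summable_abs_energyTerm hd hf hg,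
    fun f hf => ⟨_, SphereSpline.toL2_synth_fourierCoeff hd hm hf, fun g hg =>
      SphereSpline.toL2_injective d
        (hg.trans (SphereSpline.toL2_synth_fourierCoeff hd hm hf).symm)⟩,
    SphereSpline.isReproducingKernel_kernel hd hm,
    SphereSpline.continuous_kernel Y hd hm ℓ,
    SphereSpline.isStrictlyPosDef_kernel Y hd hm ℓ⟩
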